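/- Let $n\in\mathbb N$. For $x,\xi\in\mathbb R^n$ let $T_xf(t)=f(t-x)$ and $M_\xi f(t)=e^{2\pi i\,\xi\cdot t}f(t)$, extended to $\mathcal S'(\mathbb R^n)$ by duality. A translation-modulation invariant Banach space of distributions (TMIB) on $\mathbb R^n$ is a (complex) Banach space $E$ with dense continuous inclusions $\mathcal S(\mathbb R^n)\hookrightarrow E\hookrightarrow\mathcal S'(\mathbb R^n)$ such that $T_x(E)\subseteq E$ and $M_\xi(E)\subseteq E$ for all $x,\xi\in\mathbb R^n$, and such that there are $C_0,C_1,\tau_0,\tau_1>0$ with $$\|T_x\|_{\mathcal L(E)}\le C_0(1+|x|)^{\tau_0},\qquad \|M_{-\xi}\|_{\mathcal L(E)}\le C_1(1+|\xi|)^{\tau_1}\qquad(x,\xi\in\mathbb R^n).$$ A DTMIB on $\mathbb R^n$ is the strong dual $E=E_0'$ of a TMIB $E_0$ on $\mathbb R^n$, regarded as a subspace of $\mathcal S'(\mathbb R^n)$ by restricting functionals from $E_0$ to $\mathcal S(\mathbb R^n)$. Let $E$ be a TMIB or a DTMIB on $\mathbb R^n$, let $B$ be a real $n\times n$ matrix,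 let $\Lambda$ be a lattice in $\mathbb R^n$ (a discrete subgroup that spans the real vector space $\mathbb R^n$), and let $U$ be a bounded open neighbourhood of the origin such that the sets $\lambda+U$, $\lambda\in\Lambda$, are pairwise disjoint. Let $\mathcal D(U)$ be the space of complex-valued smooth functions on $\mathbb R^n$ with compact support contained in $U$. The twisted translation is $T^B_x f(t)=f(t-x)\,e^{-2\pi i\,Bx\cdot(t-x)}$. For $\chi\in\mathcal D(U)\setminus\{0\}$ and $c=(c_\lambda)_{\lambda\in\Lambda}\in\mathbb C^\Lambda$ let $S_\chi(c)=\sum_{\lambda\in\Lambda}c_\lambda T^B_\lambda\chi$ (a locally finite sum, which defines an element of $\mathcal D'(\mathbb R^n)$), and set $$E^B_{d,\chi}(\Lambda)=\{c\in\mathbb C^\Lambda \mid S_\chi(c)\in E\},\qquad \|c\|_{E^B_{d,\chi}(\Lambda)}=\|S_\chi(c)\|_E .$$ **Theorem 5.2.** (i) For every $\chi\in\mathcal D(U)\setminus\{0\}$, the space $E^B_{d,\chi}(\Lambda)$ with the norm $\|\cdot\|_{E^B_{d,\chi}(\Lambda)}$ is a Banach space. (ii) For all $\chi_1,\chi_2\in\mathcal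 D(U)\setminus\{0\}$ one has $E^B_{d,\chi_1}(\Lambda)=E^B_{d,\chi_2}(\Lambda)$ as sets of sequences, and the two norms are equivalent: there is $C>0$ such that $\|c\|_{E^B_{d,\chi_1}(\Lambda)}\le C\|c\|_{E^B_{d,\chi_2}(\Lambda)}$ and $\|c\|_{E^B_{d,\chi_2}(\Lambda)}\le C\|c\|_{E^B_{d,\chi_1}(\Lambda)}$ for all $c$ in this space. -/

import Mathlib

open MeasureTheory
open scoped SchwartzMap Distributions ContDiff

universe u v

namespace DiscreteTMIB

/-- The Euclidean space `ℝⁿ`. -/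
abbrev Rn (n : ℕ) : Type := EuclideanSpace ℝ (Fin n)

/-- The character `t ↦ exp (2πi t·ξ)` of `ℝⁿ`. -/
noncomputable def character {n : ℕ} (ξ : Rn n) (t : Rn n) : ℂ :=
  Complex.exp (2 * Real.pi * Complex.I * (inner ℝ t ξ : ℝ))

/-- Characters are smooth with bounded derivatives; hence multiplication by a character is the
genuine multiplication on the Schwartz space (see `modulation_apply`). -/
theorem character_hasTemperateGrowth {n : ℕ} (ξ : Rn n) :
    (character ξ).HasTemperateGrowth := by
  have h : Function.HasTemperateGrowth
      (fun s : ℝ => Complex.exp ((2 * Real.pi * Complex.I) * (s : ℂ))) := by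
    refine ⟨(contDiff_const.mul Complex.ofRealCLM.contDiff).cexp, fun k => ⟨0, ‖(2 * Real.pi * Complex.I : ℂ)‖ ^ k, fun s => ?_⟩⟩
    have key : ∀ k : ℕ, iteratedDeriv k
        (fun s : ℝ => Complex.exp ((2 * Real.pi * Complex.I) * (s : ℂ))) =
        fun s : ℝ => (2 * Real.pi * Complex.I) ^ k *
          Complex.exp ((2 * Real.pi * Complex.I) * (s : ℂ)) := by
      intro k
      induction k with
      | zero => simp
      | succ k ih =>
        rw [iteratedDeriv_succ, ih]
        funext s
        have h1 : HasDerivAt (fun s : ℝ => (2 * Real.pi * Complex.I) * (s : ℂ))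
            ((2 * Real.pi * Complex.I) * 1) s :=
          (Complex.ofRealCLM.hasDerivAt (x := s)).const_mul _
        have h2 := (h1.cexp).const_mul ((2 * Real.pi * Complex.I) ^ k)
        rw [h2.deriv]
        ring
    rw [norm_iteratedFDeriv_eq_norm_iteratedDeriv, key, norm_mul, norm_pow, pow_zero]
    have : (2 * Real.pi * Complex.I) * (s : ℂ) = ((2 * Real.pi * s : ℝ) : ℂ) * Complex.I := by
      push_cast; ring
    rw [this, Complex.norm_exp_ofReal_mul_I]
  have h' : Function.HasTemperateGrowth (fun t : Rn n => (inner ℝ t ξ : ℝ)) := by fun_prop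
  exact h.comp h'

/-- The translation operator `T_x` on tempered distributions, the transpose of `T_{-x}` on
Schwartz functions; on functions it is `T_x f (t) = f (t - x)`. -/
noncomputable def translation {n : ℕ} (x : Rn n) : 𝓢'(Rn n, ℂ) →L[ℂ] 𝓢'(Rn n, ℂ) :=
  PointwiseConvergenceCLM.precomp ℂ (SchwartzMap.compSubConstCLM ℂ (-x))

/-- The modulation operator `M_ξ` on tempered distributions, i.e. multiplication by the
character `t ↦ exp (2πi t·ξ)`. -/
noncomputable def modulation {n : ℕ} (ξ : Rn n) : 𝓢'(Rn n, ℂ) →L[ℂ] 𝓢'(Rn n, ℂ) :=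
  TemperedDistribution.smulLeftCLM ℂ (character ξ)

/-- `⟨T_x u, φ⟩ = ⟨u, φ (· + x)⟩`. -/
theorem translation_apply {n : ℕ} (x : Rn n) (u : 𝓢'(Rn n, ℂ)) (φ ψ : 𝓢(Rn n, ℂ))
    (h : ∀ t, ψ t = φ (t + x)) : translation x u φ = u ψ := by
  have : SchwartzMap.compSubConstCLM ℂ (-x) φ = ψ := by
    ext t; simp [h]
  rw [← this]
  rfl

/-- `⟨M_ξ u, φ⟩ = ⟨u, exp (2πi ·ξ) φ⟩`. -/
theorem modulation_apply {n : ℕ} (ξ : Rn n) (u : 𝓢'(Rn n, ℂ)) (φ ψ : 𝓢(Rn n, ℂ))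
    (h : ∀ t, ψ t = character ξ t * φ t) : modulation ξ u φ = u ψ := by
  have : SchwartzMap.smulLeftCLM ℂ (character ξ) φ = ψ := by
    ext t
    rw [SchwartzMap.smulLeftCLM_apply_apply (character_hasTemperateGrowth ξ), h, smul_eq_mul]
  rw [← this]
  rfl

/-- A Banach space `E` of tempered distributions on `ℝⁿ` is given by its continuous inclusion map
`ι` into `𝓢'(ℝⁿ)`. It is a translation-modulation invariant Banach space of distributions (TMIB)
if `𝓢(ℝⁿ)` is continuously and densely included in `E`, if `E` is invariant under all
translations and modulations, and if the operator norms of `T_x` and `M_ξ` on `E` are polynomially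
bounded in `x` and `ξ`.

(Mathlib's `𝓢'` carries the weak-* topology; for maps from a Banach space into `𝓢'`, continuity
for it is the same as continuity for the strong topology, by the uniform boundedness principle.) -/
structure IsTMIB {n : ℕ} {E : Type u} [NormedAddCommGroup E] [NormedSpace ℂ E]
    (ι : E →L[ℂ] 𝓢'(Rn n, ℂ)) : Prop where
  complete : CompleteSpace E
  injective : Function.Injective ι
  dense_schwartz : ∃ j : 𝓢(Rn n, ℂ) →L[ℂ] E, DenseRange j ∧
    ∀ φ, ι (j φ) = SchwartzMap.toTemperedDistributionCLM (Rn n) ℂ volume φ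
  translation_mem : ∀ (x : Rn n) (e : E), translation x (ι e) ∈ Set.range ι
  modulation_mem : ∀ (ξ : Rn n) (e : E), modulation ξ (ι e) ∈ Set.range ι
  /-- `‖T_x‖ ≤ C (1 + |x|) ^ τ` on `E`; here `e'` is `T_x e`. -/
  translation_bound : ∃ τ > (0 : ℝ), ∃ C > (0 : ℝ), ∀ (x : Rn n) (e e' : E),
    ι e' = translation x (ι e) → ‖e'‖ ≤ C * (1 + ‖x‖) ^ τ * ‖e‖
  /-- `‖M_ξ‖ ≤ C (1 + |ξ|) ^ τ` on `E`; here `e'` is `M_ξ e`. -/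
  modulation_bound : ∃ τ > (0 : ℝ), ∃ C > (0 : ℝ), ∀ (ξ : Rn n) (e e' : E),
    ι e' = modulation ξ (ι e) → ‖e'‖ ≤ C * (1 + ‖ξ‖) ^ τ * ‖e‖

/-- A dual translation-modulation invariant Banach space of distributions (DTMIB) on `ℝⁿ` is the
strong dual of a TMIB `E₀`, regarded as a space of tempered distributions by restricting
functionals on `E₀` to `𝓢(ℝⁿ) ⊆ E₀`. -/
def IsDTMIB {n : ℕ} {E : Type u} [NormedAddCommGroup E] [NormedSpace ℂ E]
    (ι : E →L[ℂ] 𝓢'(Rn n, ℂ)) : Prop :=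
  ∃ (E₀ : Type v) (_ : NormedAddCommGroup E₀) (_ : NormedSpace ℂ E₀)
    (ι₀ : E₀ →L[ℂ] 𝓢'(Rn n, ℂ)), IsTMIB ι₀ ∧
    ∃ Φ : E ≃ₗᵢ[ℂ] StrongDual ℂ E₀, ∀ (e : E) (φ : 𝓢(Rn n, ℂ)) (g : E₀),
      ι₀ g = SchwartzMap.toTemperedDistributionCLM (Rn n) ℂ volume φ → ι e φ = Φ e g

/-- The twisted translation `T^B_x f (t) = f (t - x) exp (-2πi Bx·(t - x))`. -/
noncomputable def twistedTranslation {n : ℕ} (B : Matrix (Fin n) (Fin n) ℝ) (x : Rn n)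
    (f : Rn n → ℂ) (t : Rn n) : ℂ :=
  f (t - x) * Complex.exp
    (-(2 * Real.pi * Complex.I * (inner ℝ (Matrix.toEuclideanLin B x) (t - x) : ℝ)))

/-- The function `S_χ(c) = ∑_{λ ∈ Λ} c_λ T^B_λ χ`. For `χ` of compact support and `Λ` a lattice
the sum is locally finite, so that it converges in `𝓓'(ℝⁿ)` to this (smooth) function. -/
noncomputable def synthesis {n : ℕ} (B : Matrix (Fin n) (Fin n) ℝ) (Λ : Submodule ℤ (Rn n))
    (χ : Rn n → ℂ) (c : Λ → ℂ) (t : Rn n) : ℂ :=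
  ∑ᶠ l : Λ, c l * twistedTranslation B (l : Rn n) χ t

/-- The tempered distribution `u` coincides in `𝓓'(ℝⁿ)` with the locally integrable
function `f`. -/
def EqInDistributions {n : ℕ} (u : 𝓢'(Rn n, ℂ)) (f : Rn n → ℂ) : Prop :=
  ∀ ψ : 𝓢(Rn n, ℂ), HasCompactSupport ψ → u ψ = ∫ t, f t * ψ t

/-- The discrete space `E^B_{d,χ}(Λ) = {c ∈ ℂ^Λ | S_χ(c) ∈ E}`. -/
def discreteSpace {n : ℕ} {E : Type u} [NormedAddCommGroup E] [NormedSpace ℂ E]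
    (ι : E →L[ℂ] 𝓢'(Rn n, ℂ)) (B : Matrix (Fin n) (Fin n) ℝ) (Λ : Submodule ℤ (Rn n))
    (χ : Rn n → ℂ) : Set (Λ → ℂ) :=
  {c | ∃ e : E, EqInDistributions (ι e) (synthesis B Λ χ c)}

/-- The norm `‖c‖ = ‖S_χ(c)‖_E` on `E^B_{d,χ}(Λ)`. As `ι` is injective and compactly supported
smooth functions are dense in `𝓢(ℝⁿ)`, there is exactly one `e ∈ E` that equals `S_χ(c)`, so the
infimum is over a single number. -/
noncomputable def discreteNorm {n : ℕ} {E : Type u} [NormedAddCommGroup E] [NormedSpace ℂ E]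
    (ι : E →L[ℂ] 𝓢'(Rn n, ℂ)) (B : Matrix (Fin n) (Fin n) ℝ) (Λ : Submodule ℤ (Rn n))
    (χ : Rn n → ℂ) (c : Λ → ℂ) : ℝ :=
  sInf {r : ℝ | ∃ e : E, EqInDistributions (ι e) (synthesis B Λ χ c) ∧ r = ‖e‖}

/-- The subset `S` of the complex vector space `V` is a linear subspace, `N` restricts to a norm
on `S`, and `S` is complete for this norm. -/
structure IsBanachSpaceOn {V : Type u} [AddCommGroup V] [Module ℂ V] (S : Set V) (N : V → ℝ) :
    Prop where
  zero_mem : (0 : V) ∈ S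
  add_mem : ∀ c ∈ S, ∀ d ∈ S, c + d ∈ S
  smul_mem : ∀ (a : ℂ), ∀ c ∈ S, a • c ∈ S
  norm_nonneg : ∀ c ∈ S, 0 ≤ N c
  norm_eq_zero : ∀ c ∈ S, (N c = 0 ↔ c = 0)
  norm_smul : ∀ (a : ℂ), ∀ c ∈ S, N (a • c) = ‖a‖ * N c
  norm_add_le : ∀ c ∈ S, ∀ d ∈ S, N (c + d) ≤ N c + N d
  complete : ∀ s : ℕ → V, (∀ k, s k ∈ S) →
    (∀ ε > 0, ∃ K, ∀ k ≥ K, ∀ l ≥ K, N (s k - s l) < ε) →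
    ∃ c ∈ S, Filter.Tendsto (fun k => N (s k - c)) Filter.atTop (nhds 0)

end DiscreteTMIB

open DiscreteTMIB

/-!
Both parts rest on the biorthogonality of the twisted translates: if `ψ` is supported in the support
of `χ₁` and `∫ χ₁ ψ = 1`, then the disjointness of the sets `l + U` gives
`⟨T^B_l χ₁, T^{-B}_m ψ⟩ = δ_{lm}`, because the phases of `T^B_l` and `T^{-B}_l` cancel
(`integral_twistedTranslation_mul`). Hence `c_l = ⟨S_χ₁(c), T^{-B}_l ψ⟩` depends continuously on the
distribution `S_χ₁(c)`. Part (i) follows from this and the completeness of `E`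
(`isBanachSpaceOn_discreteSpace`).

For part (ii), the frame operator `A f = ∑_l ⟨f, T^{-B}_l ψ⟩ T^B_l χ₂` maps `S_χ₁(c)` to `S_χ₂(c)`,
so it suffices that `A` is bounded on `E`. Let `E` be a TMIB. Substituting `s = t - y` in its kernel,
`A f (t) = ∫ K(t, y) f(t - y) dy` with
`K(t, y) = ∑_l ψ(t - y - l) χ₂(t - l) e^{-2πi Bl·y} = e^{-2πi Bt·y} ∑_l q_y(t - l)`, where
`q_y(t) = ψ(t - y) χ₂(t) e^{2πi Bt·y}`. By Poisson summation (`hasSum_fourier_intVec`) the periodic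
function `∑_l q_y(· - l)` is a Fourier series whose coefficients decrease rapidly, uniformly in `y`
(`exists_fourier_decay`). So `A` is a superposition of time-frequency shifts with integrable
coefficients that outweigh the polynomial growth of their norms: `exists_norm_slice_le` bounds the
part belonging to one `y`, and `exists_norm_kernel_le` integrates over `y`, which stays in a bounded
set. These bounds are obtained for compactly supported Schwartz functions, which are dense, and `A`
is extended to `E` by continuity (`IsTMIB.exists_frameOperator`).

If `E` is the dual of a TMIB `E₀`, the transpose of `A` is the operator of the same kind with `-B` for
`B` and with `ψ` and `χ₂` interchanged. It is bounded on `E₀`, so `A` is bounded on `E`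
(`exists_transfer`).
-/

namespace DiscreteTMIB

/-! ### Schwartz functions of compact support -/

section Schwartz

variable {P V : Type*} [NormedAddCommGroup P] [NormedSpace ℝ P] [NormedAddCommGroup V]
  [NormedSpace ℝ V]

/-- A jointly smooth, compactly supported function of a parameter and of a variable is a
continuous family of Schwartz functions. -/
theorem continuous_schwartz_of_contDiff {G : P × V → ℂ} (hG : ContDiff ℝ ∞ G)
    (hc : HasCompactSupport G) {Gs : P → 𝓢(V, ℂ)} (hGs : ∀ p t, Gs p t = G (p, t)) :
    Continuous Gs := by
  rw [continuous_iff_continuousAt]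
  intro p₀
  refine ((schwartz_withSeminorms ℝ V ℂ).tendsto_nhds Gs (Gs p₀)).2 ?_
  rintro ⟨k, m⟩ ε hε
  let L : ContinuousMultilinearMap ℝ (fun _ : Fin m => P × V) ℂ →L[ℝ]
      ContinuousMultilinearMap ℝ (fun _ : Fin m => V) ℂ :=
    ContinuousMultilinearMap.compContinuousLinearMapL
      (fun _ : Fin m => ContinuousLinearMap.inr ℝ P V)
  let H : P × V → ContinuousMultilinearMap ℝ (fun _ : Fin m => V) ℂ := fun q =>
    ‖q.2‖ ^ k • L (iteratedFDeriv ℝ m G q)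
  have hHcont : Continuous H := by
    refine Continuous.smul (continuous_snd.norm.pow k) ?_
    exact L.continuous.comp (hG.continuous_iteratedFDeriv (by exact_mod_cast le_top))
  have hHsupp : HasCompactSupport H := by
    refine (hc.iteratedFDeriv (𝕜 := ℝ) m).mono ?_
    intro q hq hq'
    refine hq ?_
    change ‖q.2‖ ^ k • L (iteratedFDeriv ℝ m G q) = 0
    rw [hq', map_zero]
    exact smul_zero (A := ContinuousMultilinearMap ℝ (fun _ : Fin m => V) ℂ) (‖q.2‖ ^ k)
  -- The derivative in the variable alone is the joint derivative restricted to the second factor.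
  have hder : ∀ p t, iteratedFDeriv ℝ m (Gs p) t =
      L (iteratedFDeriv ℝ m G (p, t)) := by
    intro p t
    have h1 : (Gs p : V → ℂ) = (fun q => G (q + (p, 0))) ∘ ContinuousLinearMap.inr ℝ P V := by
      ext t; simp [hGs]
    rw [h1, ContinuousLinearMap.iteratedFDeriv_comp_right _
      (f := fun q => G (q + (p, 0))) (n := ∞) (hG.comp (by fun_prop)) t
      (by exact_mod_cast le_top), iteratedFDeriv_comp_add_right]
    simp only [ContinuousLinearMap.inr_apply, Prod.mk_add_mk, zero_add, add_zero]
    rfl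
  have hu := hHsupp.uniformContinuous_of_continuous hHcont
  obtain ⟨δ, hδ, hδ'⟩ := Metric.uniformContinuous_iff.1 hu (ε / 2) (half_pos hε)
  filter_upwards [Metric.ball_mem_nhds p₀ hδ] with p hp
  refine lt_of_le_of_lt (SchwartzMap.seminorm_le_bound ℝ k m _ (half_pos hε).le fun t => ?_)
    (half_lt_self hε)
  have hsub : iteratedFDeriv ℝ m (Gs p - Gs p₀ : 𝓢(V, ℂ)) t =
      iteratedFDeriv ℝ m (Gs p) t - iteratedFDeriv ℝ m (Gs p₀) t := by
    have := iteratedFDeriv_sub_apply (x := t) ((Gs p).smooth m).contDiffAt ((Gs p₀).smooth m).contDiffAt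
    simpa using! this
  have hd : dist (p, t) (p₀, t) < δ := by simpa [Prod.dist_eq, hδ] using hp
  have := (hδ' hd).le
  simp only [H] at this
  rw [dist_eq_norm, ← hder, ← hder] at this
  calc ‖t‖ ^ k * ‖iteratedFDeriv ℝ m (Gs p - Gs p₀ : 𝓢(V, ℂ)) t‖
      = ‖‖t‖ ^ k • (iteratedFDeriv ℝ m (Gs p) t - iteratedFDeriv ℝ m (Gs p₀) t)‖ := by
        rw [hsub, norm_smul, norm_pow, norm_norm]
    _ ≤ ε / 2 := le_of_eq_of_le (congrArg norm (smul_sub _ _ _)) this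

theorem toSchwartzMap_apply {f : V → ℂ} (h₁ : HasCompactSupport f) (h₂ : ContDiff ℝ ∞ f) (t : V) :
    h₁.toSchwartzMap h₂ t = f t := rfl

/-- The Schwartz functions of compact support. -/
def compactSchwartz (V : Type*) [NormedAddCommGroup V] [NormedSpace ℝ V] :
    Submodule ℂ 𝓢(V, ℂ) where
  carrier := {f | HasCompactSupport f}
  zero_mem' := HasCompactSupport.zero
  add_mem' hf hg := HasCompactSupport.add hf hg
  smul_mem' c _ hf := HasCompactSupport.smul_left (f := fun _ => c) hf

/-- The cut-offs `t ↦ b (ε t) f t`, with a bump function `b` equal to `1` near `0`, converge to `f`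
in `𝓢` as `ε → 0`. -/
theorem dense_compactSchwartz [FiniteDimensional ℝ V] :
    Dense (compactSchwartz V : Set 𝓢(V, ℂ)) := by
  let b : ContDiffBump (0 : V) := ⟨1, 2, one_pos, one_lt_two⟩
  let η : V → ℂ := fun t => 1 - (b t : ℂ)
  have hbs : ContDiff ℝ ∞ fun t => (b t : ℂ) := Complex.ofRealCLM.contDiff.comp b.contDiff
  have hbc : HasCompactSupport fun t => (b t : ℂ) := b.hasCompactSupport.comp_left Complex.ofReal_zero
  have hη : ContDiff ℝ ∞ η := contDiff_const.sub hbs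
  have hηb : ∀ i : ℕ, ∃ C : ℝ, ∀ t, ‖iteratedFDeriv ℝ i η t‖ ≤ C := by
    intro i
    obtain ⟨C, hC⟩ := (hbc.iteratedFDeriv (𝕜 := ℝ) i).exists_bound_of_continuous
      (hbs.continuous_iteratedFDeriv (by exact_mod_cast le_top))
    obtain ⟨C', hC'⟩ : ∃ C', ∀ t : V, ‖iteratedFDeriv ℝ i (fun _ : V => (1 : ℂ)) t‖ ≤ C' := by
      cases i with
      | zero => exact ⟨1, fun t => by simp⟩
      | succ i => exact ⟨0, fun t => by simp [iteratedFDeriv_succ_const]⟩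
    refine ⟨C' + C, fun t => ?_⟩
    have : iteratedFDeriv ℝ i η t = _ := iteratedFDeriv_sub_apply (x := t)
      (f := fun _ : V => (1 : ℂ)) (g := fun t => (b t : ℂ)) contDiffAt_const
      (hbs.of_le (by exact_mod_cast le_top) |>.contDiffAt)
    rw [this]
    exact (norm_sub_le _ _).trans (add_le_add (hC' t) (hC t))
  choose C hC using hηb
  intro f
  have hcs : ∀ ε : ℝ, ε ≠ 0 → HasCompactSupport fun t => (b (ε • t) : ℂ) * f t := fun ε h =>
    (hbc.comp_homeomorph (Homeomorph.smulOfNeZero ε h)).mul_right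
  have hsm : ∀ ε : ℝ, ContDiff ℝ ∞ fun t => (b (ε • t) : ℂ) * f t := fun ε =>
    (hbs.comp (contDiff_const_smul ε)).mul (f.smooth ⊤)
  let fs : ℝ → 𝓢(V, ℂ) := fun ε => if h : ε = 0 then 0 else
    (hcs ε h).toSchwartzMap (hsm ε)
  refine mem_closure_of_tendsto (f := fs) (b := nhdsWithin 0 (Set.Ioi 0)) ?_ ?_
  · refine ((schwartz_withSeminorms ℝ V ℂ).tendsto_nhds fs f).2 ?_
    rintro ⟨k, m⟩ r hr
    let M : ℝ := ∑ i ∈ Finset.range (m + 1),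
      (m.choose i : ℝ) * C i * SchwartzMap.seminorm ℝ (k + 1) (m - i) f
    have hC0 : ∀ i, 0 ≤ C i := fun i => (norm_nonneg _).trans (hC i 0)
    have hM : 0 ≤ M := Finset.sum_nonneg fun i _ =>
      mul_nonneg (mul_nonneg (by positivity) (hC0 i)) (apply_nonneg _ _)
    have hev : ∀ᶠ ε : ℝ in nhdsWithin 0 (Set.Ioi 0), ε * M < r := by
      have : Filter.Tendsto (fun ε : ℝ => ε * M) (nhds 0) (nhds (0 * M)) :=
        (continuous_id.mul continuous_const).tendsto 0
      rw [zero_mul] at this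
      exact nhdsWithin_le_nhds (this.eventually (gt_mem_nhds hr))
    have hev1 : ∀ᶠ ε : ℝ in nhdsWithin 0 (Set.Ioi 0), ε ≤ 1 :=
      nhdsWithin_le_nhds (eventually_le_nhds one_pos)
    filter_upwards [hev, hev1, self_mem_nhdsWithin] with ε hεM hε1 hε0
    have hε0' : 0 < ε := hε0
    refine lt_of_le_of_lt (SchwartzMap.seminorm_le_bound ℝ k m _
      (mul_nonneg hε0'.le hM) fun t => ?_) hεM
    have hdiff : ((fs ε - f : 𝓢(V, ℂ)) : V → ℂ) = -(fun t => η (ε • t) * f t) := by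
      ext t
      simp only [fs, hε0'.ne', dite_false, sub_apply, Pi.neg_apply, η]
      rw [toSchwartzMap_apply]
      ring
    rw [hdiff, iteratedFDeriv_neg_apply, norm_neg]
    by_cases ht : ‖ε • t‖ < 1
    · have hz : (fun t => η (ε • t) * f t) =ᶠ[nhds t] fun _ => 0 := by
        have : ∀ᶠ s in nhds t, ‖ε • s‖ < 1 :=
          (continuous_const_smul ε).norm.continuousAt.eventually (gt_mem_nhds ht)
        filter_upwards [this] with s hs
        have : b (ε • s) = 1 := b.one_of_mem_closedBall (by simpa [b] using hs.le)
        simp [η, this]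
      rw [(hz.iteratedFDeriv ℝ m).eq_of_nhds]
      have h0 : iteratedFDeriv ℝ m (fun _ : V => (0 : ℂ)) t = 0 := by simp
      rw [h0]
      simpa using mul_nonneg hε0'.le hM
    · have ht' : 1 ≤ ε * ‖t‖ := by
        rw [not_lt, norm_smul, Real.norm_eq_abs, abs_of_pos hε0'] at ht; exact ht
      have h1 := norm_iteratedFDeriv_mul_le (𝕜 := ℝ) (f := fun t => η (ε • t)) (g := f) (N := ∞)
        (hη.comp (contDiff_const_smul ε)) (f.smooth ⊤) t (n := m) (by exact_mod_cast le_top)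
      -- One extra power of `‖t‖` is traded for the factor `ε`, as `1 ≤ ε ‖t‖` here.
      calc ‖t‖ ^ k * ‖iteratedFDeriv ℝ m (fun t => η (ε • t) * f t) t‖
          ≤ ‖t‖ ^ k * (ε * ‖t‖) * ∑ i ∈ Finset.range (m + 1), (m.choose i : ℝ) *
            ‖iteratedFDeriv ℝ i (fun t => η (ε • t)) t‖ * ‖iteratedFDeriv ℝ (m - i) f t‖ :=
            mul_le_mul (le_mul_of_one_le_right (by positivity) ht') h1 (by positivity)
              (by positivity)
        _ = ε * ∑ i ∈ Finset.range (m + 1), (m.choose i : ℝ) *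
            ‖iteratedFDeriv ℝ i (fun t => η (ε • t)) t‖ *
              (‖t‖ ^ (k + 1) * ‖iteratedFDeriv ℝ (m - i) f t‖) := by
            rw [Finset.mul_sum, Finset.mul_sum]
            refine Finset.sum_congr rfl fun i _ => ?_
            ring
        _ ≤ ε * M := by
            refine mul_le_mul_of_nonneg_left (Finset.sum_le_sum fun i _ => ?_) hε0'.le
            refine mul_le_mul (mul_le_mul_of_nonneg_left ?_ (by positivity))
              (SchwartzMap.le_seminorm ℝ _ _ f t) (by positivity)
              (mul_nonneg (by positivity) (hC0 i))
            rw [iteratedFDeriv_comp_const_smul ε (hη.of_le (by exact_mod_cast le_top))]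
            simp only [norm_smul, norm_pow, Real.norm_eq_abs, abs_of_pos hε0']
            exact (mul_le_of_le_one_left (norm_nonneg _) (pow_le_one₀ hε0'.le hε1)).trans (hC i _)
  · filter_upwards [self_mem_nhdsWithin] with ε hε
    have hε0 : ε ≠ 0 := (Set.mem_Ioi.1 hε).ne'
    simp only [fs, hε0, dite_false]
    exact hcs ε hε0

end Schwartz

/-! ### Poisson summation over `ℤⁿ` -/

section Poisson

open scoped FourierTransform

variable {n : ℕ}

/-- The vector of `ℤⁿ ⊆ ℝⁿ` with the given coordinates. -/
def intVec (m : Fin n → ℤ) : Rn n := WithLp.toLp 2 fun i => (m i : ℝ)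

/-- Only finitely many integer translates of a compactly supported function meet a given ball, so
that its periodization is a locally finite sum. -/
theorem finite_setOf_translate_ne_zero {Q : (Fin n → ℝ) → ℂ} (hc : HasCompactSupport Q) (R : ℝ) :
    {k : Fin n → ℤ | ∃ x : Fin n → ℝ, ‖x‖ ≤ R ∧ Q (x + fun i => (k i : ℝ)) ≠ 0}.Finite := by
  obtain ⟨S, hS⟩ := hc.isBounded.subset_closedBall 0
  refine (Set.finite_Icc (fun _ => -⌈R + S⌉) (fun _ => ⌈R + S⌉)).subset ?_
  rintro k ⟨x, hx, hxk⟩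
  have h1 : ‖x + fun i => (k i : ℝ)‖ ≤ S := by simpa using hS (subset_tsupport _ hxk)
  have h2 : ∀ i, |(k i : ℝ)| ≤ R + S := by
    intro i
    have h3 : ‖x + (fun i => (k i : ℝ)) - x‖ ≤ S + R := (norm_sub_le _ _).trans (add_le_add h1 hx)
    have h4 := norm_le_pi_norm (x + (fun i => (k i : ℝ)) - x) i
    simp only [add_sub_cancel_left, Real.norm_eq_abs] at h3 h4
    linarith
  have h5 : ∀ i, |k i| ≤ ⌈R + S⌉ := by
    intro i
    have : ((|k i| : ℤ) : ℝ) ≤ (⌈R + S⌉ : ℝ) := by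
      push_cast
      exact (h2 i).trans (Int.le_ceil _)
    exact_mod_cast this
  exact ⟨fun i => (abs_le.1 (h5 i)).1, fun i => (abs_le.1 (h5 i)).2⟩

theorem mFourier_coe (m : Fin n → ℤ) (x : Fin n → ℝ) :
    UnitAddTorus.mFourier m (fun i => (x i : UnitAddCircle)) =
      character (intVec m) (WithLp.toLp 2 x) := by
  simp only [UnitAddTorus.mFourier, ContinuousMap.coe_mk, fourier_coe_apply, character, intVec,
    ← Complex.exp_sum]
  congr 1
  simp only [PiLp.inner_apply, Complex.ofReal_sum, Finset.mul_sum]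
  refine Finset.sum_congr rfl fun i _ => ?_
  simp
  ring

/-- Unfolding: integrating the periodization over the unit cube is integrating over `ℝⁿ`. -/
theorem integral_cube_finsum {f : (Fin n → ℝ) → ℂ} (hf : Continuous f) (hc : HasCompactSupport f) :
    ∫ x in {x : Fin n → ℝ | ∀ i, x i ∈ Set.Ioc (0 : ℝ) (0 + 1)},
      ∑ᶠ k : Fin n → ℤ, f (x + fun i => (k i : ℝ)) = ∫ x, f x := by
  have hbox : ({x : Fin n → ℝ | ∀ i, x i ∈ Set.Ioc (0 : ℝ) (0 + 1)} : Set (Fin n → ℝ)) =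
      Set.univ.pi fun _ => Set.Ioc (0 : ℝ) 1 := by ext; simp
  rw [hbox]
  have hae : (Set.univ.pi fun _ : Fin n => Set.Ioc (0 : ℝ) 1) =ᵐ[volume]
      Set.univ.pi fun _ : Fin n => Set.Ico (0 : ℝ) 1 :=
    (Measure.univ_pi_Ioc_ae_eq_Icc (μ := fun _ : Fin n => (volume : Measure ℝ))).trans
      (Measure.univ_pi_Ico_ae_eq_Icc (μ := fun _ : Fin n => (volume : Measure ℝ))).symm
  have hfd := ZSpan.isAddFundamentalDomain (Pi.basisFun ℝ (Fin n)) volume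
  have hdom : ZSpan.fundamentalDomain (Pi.basisFun ℝ (Fin n)) =
      Set.univ.pi fun _ : Fin n => Set.Ico (0 : ℝ) 1 := ZSpan.fundamentalDomain_pi_basisFun
  rw [hdom] at hfd
  have hint : ∀ k : Fin n → ℤ, Integrable (fun x => f (x + fun i => (k i : ℝ))) volume := fun k =>
    (hf.integrable_of_hasCompactSupport hc).comp_add_right _
  have : VAddInvariantMeasure (Submodule.span ℤ (Set.range (Pi.basisFun ℝ (Fin n))))
      (Fin n → ℝ) volume := ⟨fun c s _ => measure_preimage_add volume (c : Fin n → ℝ) s⟩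
  rw [hfd.integral_eq_tsum'' f (hf.integrable_of_hasCompactSupport hc)]
  let b := (Pi.basisFun ℝ (Fin n)).restrictScalars ℤ
  have hb : ∀ k : Fin n → ℤ, ((b.equivFun.symm k : Submodule.span ℤ _) : Fin n → ℝ) =
      fun i => (k i : ℝ) := by
    intro k
    rw [Module.Basis.equivFun_symm_apply]
    ext i
    simp [b, Finset.sum_apply, Pi.single_apply]
  rw [← b.equivFun.symm.toEquiv.tsum_eq]
  have hfin := finite_setOf_translate_ne_zero hc 1
  have hnorm : ∀ x ∈ (Set.univ.pi fun _ : Fin n => Set.Ioc (0 : ℝ) 1), ‖x‖ ≤ 1 := by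
    intro x hx
    refine (pi_norm_le_iff_of_nonneg zero_le_one).2 fun i => ?_
    have := hx i trivial
    rw [Real.norm_eq_abs, abs_of_pos this.1]
    exact this.2
  have hmeas : MeasurableSet (Set.univ.pi fun _ : Fin n => Set.Ioc (0 : ℝ) 1) :=
    MeasurableSet.univ_pi fun _ => measurableSet_Ioc
  have h1 : ∀ k : Fin n → ℤ, ∫ x in Set.univ.pi fun _ : Fin n => Set.Ico (0 : ℝ) 1,
      f (b.equivFun.symm.toEquiv k +ᵥ x) =
        ∫ x in Set.univ.pi fun _ : Fin n => Set.Ioc (0 : ℝ) 1, f (x + fun i => (k i : ℝ)) := by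
    intro k
    rw [setIntegral_congr_set hae]
    refine integral_congr_ae (Filter.Eventually.of_forall fun x => ?_)
    have : (b.equivFun.symm.toEquiv k +ᵥ x : Fin n → ℝ) = (fun i => (k i : ℝ)) + x :=
      congrArg (· + x) (hb k)
    simp only [this, add_comm]
  simp_rw [h1]
  rw [tsum_eq_sum (s := hfin.toFinset), ← integral_finsetSum]
  · refine setIntegral_congr_fun hmeas fun x hx => ?_
    refine finsum_eq_finsetSum_of_support_subset _ ?_
    intro k hk
    simp only [Set.Finite.coe_toFinset, Set.mem_ofPred_eq]
    exact ⟨x, hnorm x hx, hk⟩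
  · exact fun k _ => (hint k).integrableOn
  · intro k hk
    refine setIntegral_eq_zero_of_forall_eq_zero fun x hx => ?_
    by_contra h
    exact hk (hfin.mem_toFinset.2 ⟨x, hnorm x hx, h⟩)

/-- Poisson summation over `ℤⁿ`: the periodization of a continuous function of compact support is
the sum of its Fourier series, whose coefficients are the values of the Fourier transform. -/
theorem hasSum_fourier_intVec {Q : Rn n → ℂ} (hQ : Continuous Q) (hc : HasCompactSupport Q)
    (hs : Summable fun m : Fin n → ℤ => 𝓕 Q (intVec m)) (x : Rn n) :
    HasSum (fun m : Fin n → ℤ => 𝓕 Q (intVec m) * character (intVec m) x)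
      (∑ᶠ k : Fin n → ℤ, Q (x + intVec k)) := by
  let Q' : (Fin n → ℝ) → ℂ := fun x => Q (WithLp.toLp 2 x)
  have hQ' : Continuous Q' := hQ.comp (PiLp.continuous_toLp 2 _)
  have hc' : HasCompactSupport Q' :=
    hc.comp_homeomorph (EuclideanSpace.equiv (Fin n) ℝ).symm.toHomeomorph
  let p : (Fin n → ℝ) → ℂ := fun x => ∑ᶠ k : Fin n → ℤ, Q' (x + fun i => (k i : ℝ))
  have hp : Continuous p := by
    refine continuous_finsum (fun k => hQ'.comp (by fun_prop)) fun x₀ => ?_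
    refine ⟨Metric.ball x₀ 1, Metric.ball_mem_nhds _ one_pos,
      (finite_setOf_translate_ne_zero hc' (‖x₀‖ + 1)).subset ?_⟩
    rintro k ⟨x, hx, hx'⟩
    refine ⟨x, ?_, hx⟩
    have : ‖x - x₀‖ < 1 := by simpa [dist_eq_norm] using hx'
    have h2 := norm_add_le x₀ (x - x₀)
    rw [add_sub_cancel] at h2
    linarith
  have hper : ∀ (x : Fin n → ℝ) (l : Fin n → ℤ), p (x + fun i => (l i : ℝ)) = p x := by
    intro x l
    simp only [p]
    rw [← finsum_comp_equiv (Equiv.addLeft l) (f := fun k : Fin n → ℤ => Q' (x + fun i => (k i : ℝ)))]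
    refine finsum_congr fun k => ?_
    congr 1
    ext i
    simp [add_assoc]
  -- The periodization descends to the torus through the section with values in `(0, 1]ⁿ`.
  let sec : UnitAddTorus (Fin n) → (Fin n → ℝ) := fun z i => (AddCircle.equivIoc 1 0 (z i) : ℝ)
  have hsec : ∀ x : Fin n → ℝ, p (sec fun i => (x i : UnitAddCircle)) = p x := by
    intro x
    have : ∀ i, ∃ l : ℤ, sec (fun i => (x i : UnitAddCircle)) i = x i + l := by
      intro i
      have h : ((sec (fun i => (x i : UnitAddCircle)) i : ℝ) : UnitAddCircle) = (x i : ℝ) :=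
        (AddCircle.equivIoc 1 0).symm_apply_apply (x i : UnitAddCircle)
      obtain ⟨l, hl⟩ := AddSubgroup.mem_zmultiples_iff.1 (QuotientAddGroup.eq_iff_sub_mem.1 h)
      exact ⟨l, by simp only [zsmul_eq_mul, mul_one] at hl; linarith⟩
    choose l hl using this
    rw [← hper x l]
    congr 1
    ext i
    exact hl i
  let pt : C(UnitAddTorus (Fin n), ℂ) := ⟨fun z => p (sec z), by
    have hq : IsOpenQuotientMap
        (Pi.map fun (_ : Fin n) (x : ℝ) => (x : UnitAddCircle)) :=
      IsOpenQuotientMap.piMap fun _ => QuotientAddGroup.isOpenQuotientMap_mk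
    refine hq.isQuotientMap.continuous_iff.2 ?_
    refine hp.congr fun x => (hsec x).symm⟩
  have hcoeff : ∀ m : Fin n → ℤ, UnitAddTorus.mFourierCoeff pt m = 𝓕 Q (intVec m) := by
    intro m
    rw [UnitAddTorus.mFourierCoeff_eq_integral _ m 0, Real.fourier_eq',
      ← (EuclideanSpace.volume_preserving_symm_measurableEquiv_toLp (Fin n)).symm.integral_comp
        (MeasurableEquiv.measurableEmbedding _)]
    let f : (Fin n → ℝ) → ℂ := fun x => character (intVec (-m)) (WithLp.toLp 2 x) * Q' x
    have hchar : Continuous fun x : Fin n → ℝ => character (intVec (-m)) (WithLp.toLp 2 x) :=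
      (character_hasTemperateGrowth _).1.continuous.comp (PiLp.continuous_toLp 2 _)
    have hf := integral_cube_finsum (f := f) (hchar.mul hQ') hc'.mul_left
    have e1 : ∀ x : Fin n → ℝ, UnitAddTorus.mFourier (-m) (fun i => (x i : UnitAddCircle)) •
        pt (fun i => (x i : UnitAddCircle)) = ∑ᶠ k : Fin n → ℤ, f (x + fun i => (k i : ℝ)) := by
      intro x
      change _ • p (sec _) = _
      rw [hsec, smul_eq_mul]
      simp only [p, f]
      rw [mul_finsum]
      refine finsum_congr fun k => ?_
      rw [← mFourier_coe]
      congr 2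
      ext i
      simp
    simp_rw [e1]
    refine hf.trans (integral_congr_ae (Filter.Eventually.of_forall fun x => ?_))
    simp only [f, Q', smul_eq_mul, character]
    congr 2
    simp [intVec, PiLp.inner_apply]
    ring
  have := UnitAddTorus.hasSum_mFourier_series_apply_of_summable (f := pt)
    (by simpa only [funext hcoeff] using hs) (fun i => (x i : UnitAddCircle))
  simp only [hcoeff, mFourier_coe] at this
  have e2 : pt (fun i => (x i : UnitAddCircle)) = ∑ᶠ k : Fin n → ℤ, Q (x + intVec k) := by
    change p (sec _) = _
    rw [hsec]
    rfl
  rw [e2] at this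
  exact this

end Poisson

/-! ### Characters and supports -/

section Character

variable {n : ℕ}

theorem norm_character (ξ t : Rn n) : ‖character ξ t‖ = 1 := by
  have : (2 * Real.pi * Complex.I * (inner ℝ t ξ : ℝ) : ℂ) =
      ((2 * Real.pi * inner ℝ t ξ : ℝ) : ℂ) * Complex.I := by push_cast; ring
  rw [character, this, Complex.norm_exp_ofReal_mul_I]

theorem contDiff_character {V : Type*} [NormedAddCommGroup V] [NormedSpace ℝ V]
    {ξ t : V → Rn n} (hξ : ContDiff ℝ ∞ ξ) (ht : ContDiff ℝ ∞ t) :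
    ContDiff ℝ ∞ fun v => character (ξ v) (t v) :=
  ContDiff.cexp (contDiff_const.mul (Complex.ofRealCLM.contDiff.comp (ht.inner ℝ hξ)))

theorem character_mul_character {ξ η ζ s t r : Rn n}
    (h : inner ℝ s ξ + inner ℝ t η = (inner ℝ r ζ : ℝ)) :
    character ξ s * character η t = character ζ r := by
  simp only [character, ← Complex.exp_add]
  rw [← h]
  push_cast
  ring_nf

theorem twistedTranslation_eq (B : Matrix (Fin n) (Fin n) ℝ) (x : Rn n) (f : Rn n → ℂ) (t : Rn n) :
    twistedTranslation B x f t = f (t - x) * character (-(Matrix.toEuclideanLin B x)) (t - x) := by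
  rw [twistedTranslation, character, inner_neg_right, real_inner_comm]
  push_cast
  ring_nf

theorem hasCompactSupport_of_forall_norm_le {V : Type*} [NormedAddCommGroup V] [ProperSpace V]
    {f : V → ℂ} (R : ℝ) (h : ∀ v, f v ≠ 0 → ‖v‖ ≤ R) : HasCompactSupport f := by
  refine HasCompactSupport.intro (isCompact_closedBall 0 R) fun v hv => ?_
  by_contra h0
  exact hv (by simpa using h v h0)

theorem exists_norm_le_of_hasCompactSupport {V : Type*} [NormedAddCommGroup V]
    {f : V → ℂ} (h : HasCompactSupport f) : ∃ R : ℝ, 0 ≤ R ∧ ∀ v, f v ≠ 0 → ‖v‖ ≤ R := by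
  obtain ⟨R, hR⟩ := h.isBounded.subset_closedBall 0
  exact ⟨max R 0, le_max_right _ _, fun v hv =>
    le_max_of_le_left (by simpa using hR (subset_tsupport _ hv))⟩

end Character

/-! ### Time-frequency shifts and superpositions in a TMIB -/

section TMIB

variable {n : ℕ} {E : Type u} [NormedAddCommGroup E] [NormedSpace ℂ E]
  {ι : E →L[ℂ] 𝓢'(Rn n, ℂ)} {j : 𝓢(Rn n, ℂ) →L[ℂ] E}

theorem apply_of_eq_toTemperedDistribution
    (hj : ∀ φ, ι (j φ) = SchwartzMap.toTemperedDistributionCLM (Rn n) ℂ volume φ)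
    (φ ψ : 𝓢(Rn n, ℂ)) : ι (j φ) ψ = ∫ t, ψ t * φ t := by
  rw [hj]
  exact SchwartzMap.toTemperedDistributionCLM_apply_apply volume φ ψ

/-- Time-frequency shifts act on the image of `𝓢(ℝⁿ)` in a TMIB with polynomial bounds. -/
theorem IsTMIB.exists_norm_shift_le (hι : IsTMIB ι)
    (hj : ∀ φ, ι (j φ) = SchwartzMap.toTemperedDistributionCLM (Rn n) ℂ volume φ) :
    ∃ τ > (0 : ℝ), ∃ σ > (0 : ℝ), ∃ C > (0 : ℝ), ∀ (x ξ : Rn n) (φ φ' : 𝓢(Rn n, ℂ)),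
      (∀ t, φ' t = character ξ t * φ (t - x)) →
        ‖j φ'‖ ≤ C * (1 + ‖x‖) ^ τ * (1 + ‖ξ‖) ^ σ * ‖j φ‖ := by
  obtain ⟨τ, hτ, C₀, hC₀, h₀⟩ := hι.translation_bound
  obtain ⟨σ, hσ, C₁, hC₁, h₁⟩ := hι.modulation_bound
  refine ⟨τ, hτ, σ, hσ, C₁ * C₀, mul_pos hC₁ hC₀, fun x ξ φ φ' h => ?_⟩
  let φ₁ : 𝓢(Rn n, ℂ) := SchwartzMap.compSubConstCLM ℂ x φ
  have hφ₁ : ∀ t, φ₁ t = φ (t - x) := fun t => by simp [φ₁]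
  have e₀ : ι (j φ₁) = translation x (ι (j φ)) := by
    ext ψ
    rw [translation_apply x _ ψ (SchwartzMap.compSubConstCLM ℂ (-x) ψ) (fun t => by simp),
      apply_of_eq_toTemperedDistribution hj, apply_of_eq_toTemperedDistribution hj,
      ← integral_add_right_eq_self _ x]
    simp [hφ₁]
  have e₁ : ι (j φ') = modulation ξ (ι (j φ₁)) := by
    ext ψ
    rw [modulation_apply ξ _ ψ (SchwartzMap.smulLeftCLM ℂ (character ξ) ψ) (fun t => by
      rw [SchwartzMap.smulLeftCLM_apply_apply (character_hasTemperateGrowth ξ), smul_eq_mul]),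
      apply_of_eq_toTemperedDistribution hj, apply_of_eq_toTemperedDistribution hj]
    refine integral_congr_ae (Filter.Eventually.of_forall fun t => ?_)
    simp only [SchwartzMap.smulLeftCLM_apply_apply (character_hasTemperateGrowth ξ), h, hφ₁,
      smul_eq_mul]
    ring
  calc ‖j φ'‖ ≤ C₁ * (1 + ‖ξ‖) ^ σ * ‖j φ₁‖ := h₁ _ _ _ e₁
    _ ≤ C₁ * (1 + ‖ξ‖) ^ σ * (C₀ * (1 + ‖x‖) ^ τ * ‖j φ‖) :=
      mul_le_mul_of_nonneg_left (h₀ _ _ _ e₀) (by positivity)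
    _ = _ := by ring

/-- Evaluation at a Schwartz function, as a continuous functional on `E`. -/
noncomputable def evalAt (ι : E →L[ℂ] 𝓢'(Rn n, ℂ)) (ψ : 𝓢(Rn n, ℂ)) : E →L[ℂ] ℂ :=
  (PointwiseConvergenceCLM.evalCLM (RingHom.id ℂ) ℂ ψ).comp ι

theorem evalAt_apply (ψ : 𝓢(Rn n, ℂ)) (e : E) : evalAt ι ψ e = ι e ψ := rfl

theorem ext_of_evalAt (hinj : Function.Injective ι) {e e' : E}
    (h : ∀ ψ, ι e ψ = ι e' ψ) : e = e' :=
  hinj (by ext ψ; exact h ψ)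

/-- Superposition of a jointly smooth compactly supported family: the Bochner integral in `E` is
the pointwise integral. -/
theorem integral_of_contDiff [CompleteSpace E] (hinj : Function.Injective ι)
    (hj : ∀ φ, ι (j φ) = SchwartzMap.toTemperedDistributionCLM (Rn n) ℂ volume φ)
    {G : Rn n × Rn n → ℂ} (hG : ContDiff ℝ ∞ G) (hc : HasCompactSupport G)
    {Gs : Rn n → 𝓢(Rn n, ℂ)} (hGs : ∀ y t, Gs y t = G (y, t)) {h : 𝓢(Rn n, ℂ)}
    (hh : ∀ t, h t = ∫ y, G (y, t)) : ∫ y, j (Gs y) = j h := by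
  have hcont : Continuous fun y => j (Gs y) :=
    j.continuous.comp (continuous_schwartz_of_contDiff hG hc hGs)
  obtain ⟨R, -, hR⟩ := exists_norm_le_of_hasCompactSupport hc
  have hsupp : HasCompactSupport fun y => j (Gs y) := by
    refine HasCompactSupport.intro (isCompact_closedBall 0 R) fun y hy => ?_
    have : Gs y = 0 := by
      ext t
      rw [hGs]
      by_contra h0
      exact hy (by simpa using (norm_fst_le (y, t)).trans (hR _ h0))
    simp [this]
  have hint : Integrable fun y => j (Gs y) := hcont.integrable_of_hasCompactSupport hsupp
  refine ext_of_evalAt hinj fun ψ => ?_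
  rw [← evalAt_apply, ← ContinuousLinearMap.integral_comp_comm _ hint,
    apply_of_eq_toTemperedDistribution hj]
  simp only [evalAt_apply, apply_of_eq_toTemperedDistribution hj, hGs, hh]
  rw [integral_integral_swap_of_hasCompactSupport (f := fun y t => ψ t * G (y, t))]
  · exact integral_congr_ae (Filter.Eventually.of_forall fun t => integral_const_mul _ _)
  · exact (ψ.continuous.comp continuous_snd).mul hG.continuous
  · exact hc.mul_left (f := fun p : Rn n × Rn n => ψ p.2)

/-- A Schwartz function that is pointwise an absolutely convergent series of modulations of `f` is
the sum of the corresponding series in `E`, so that its norm is bounded termwise. -/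
theorem norm_le_tsum_of_hasSum [CompleteSpace E] (hinj : Function.Injective ι)
    (hj : ∀ φ, ι (j φ) = SchwartzMap.toTemperedDistributionCLM (Rn n) ℂ volume φ)
    {I : Type*} [Countable I] {a : I → ℂ} {ξ : I → Rn n} {f h : 𝓢(Rn n, ℂ)} {fs : I → 𝓢(Rn n, ℂ)}
    (hfs : ∀ m t, fs m t = character (ξ m) t * f t) (ha : Summable fun m => ‖a m‖)
    (hh : ∀ t, HasSum (fun m => a m * (character (ξ m) t * f t)) (h t))
    {b : I → ℝ} (hb : Summable b) (hab : ∀ m, ‖a m‖ * ‖j (fs m)‖ ≤ b m) :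
    ‖j h‖ ≤ ∑' m, b m := by
  have hs : HasSum (fun m => a m • j (fs m)) (j h) := by
    have hsum : Summable fun m => a m • j (fs m) :=
      Summable.of_norm_bounded hb fun m => by rw [norm_smul]; exact hab m
    convert hsum.hasSum
    refine ext_of_evalAt hinj fun ψ => ?_
    rw [apply_of_eq_toTemperedDistribution hj, ← evalAt_apply, (evalAt ι ψ).map_tsum hsum]
    have hψf : Integrable fun t => ψ t * f t := by
      have := ((SchwartzMap.pairing (ContinuousLinearMap.mul ℂ ℂ)) ψ f).integrable (μ := volume)
      simpa [SchwartzMap.pairing_apply_apply] using! this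
    have hF : ∀ m, Integrable fun t => a m * (ψ t * fs m t) := by
      intro m
      refine Integrable.const_mul ?_ _
      have := ((SchwartzMap.pairing (ContinuousLinearMap.mul ℂ ℂ)) ψ (fs m)).integrable
        (μ := volume)
      simpa [SchwartzMap.pairing_apply_apply] using! this
    have hnorm : ∀ m t, ‖a m * (ψ t * fs m t)‖ = ‖a m‖ * ‖ψ t * f t‖ := by
      intro m t
      rw [hfs, norm_mul, norm_mul, norm_mul, norm_character, one_mul, norm_mul]
    have key := hasSum_integral_of_summable_integral_norm hF (by
      simp only [hnorm, integral_const_mul]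
      exact ha.mul_right _)
    have e1 : ∀ m, evalAt ι ψ (a m • j (fs m)) = ∫ t, a m * (ψ t * fs m t) := by
      intro m
      rw [map_smul, evalAt_apply, apply_of_eq_toTemperedDistribution hj, integral_const_mul,
        smul_eq_mul]
    simp only [e1, key.tsum_eq]
    refine integral_congr_ae (Filter.Eventually.of_forall fun t => ?_)
    have := ((hh t).mul_left (ψ t)).tsum_eq
    simp only [← this, hfs]
    refine tsum_congr fun m => ?_
    ring
  refine hs.norm_le_of_bounded hb.hasSum fun m => ?_
  rw [norm_smul]
  exact hab m

end TMIB

/-! ### Lattices and uniform Fourier decay -/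

section Lattice

open scoped FourierTransform

variable {n : ℕ}

/-- A lattice is the image of `ℤⁿ` under a linear automorphism of `ℝⁿ`. -/
theorem exists_lattice_equiv (Λ : Submodule ℤ (Rn n)) [DiscreteTopology Λ] [IsZLattice ℝ Λ] :
    ∃ (L : Rn n ≃L[ℝ] Rn n) (e : (Fin n → ℤ) ≃ Λ), ∀ k, (e k : Rn n) = L (intVec k) := by
  have hcard : Fintype.card (Module.Free.ChooseBasisIndex ℤ Λ) = Fintype.card (Fin n) := by
    rw [← Module.finrank_eq_card_chooseBasisIndex, ZLattice.rank ℝ]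
    simp
  let b : Module.Basis (Fin n) ℤ Λ :=
    (Module.Free.chooseBasis ℤ Λ).reindex (Fintype.equivOfCardEq hcard)
  let bR := b.ofZLatticeBasis ℝ
  refine ⟨(EuclideanSpace.equiv (Fin n) ℝ).trans bR.equivFun.symm.toContinuousLinearEquiv,
    b.equivFun.symm.toEquiv, fun k => ?_⟩
  have h1 : b.equivFun.symm.toEquiv k = ∑ i, k i • b i := b.equivFun_symm_apply k
  have h2 : ((EuclideanSpace.equiv (Fin n) ℝ).trans bR.equivFun.symm.toContinuousLinearEquiv)
      (intVec k) = ∑ i, (k i : ℝ) • bR i := bR.equivFun_symm_apply _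
  rw [h1, h2]
  simp [bR, Int.cast_smul_eq_zsmul]

/-- Summability over `ℤⁿ` is that over a lattice of rank `n`; the term at `0`, where the norm has a
junk inverse, does not matter. -/
theorem summable_one_add_norm_intVec_inv :
    Summable fun m : Fin n → ℤ => ((1 + ‖intVec m‖) ^ (n + 1))⁻¹ := by
  let Λ : Submodule ℤ (Rn n) :=
    Submodule.span ℤ (Set.range (EuclideanSpace.basisFun (Fin n) ℝ).toBasis)
  obtain ⟨L, e, he⟩ := exists_lattice_equiv Λ
  have hs := ZLattice.summable_norm_pow_inv (L := Λ) (n + 1) (by rw [ZLattice.rank ℝ]; simp)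
  have hs' := (e.summable_iff.2 hs).mul_left (‖(L : Rn n →L[ℝ] Rn n)‖ ^ (n + 1))
  refine Summable.of_norm_bounded_eventually hs' ?_
  have hfin : ∀ᶠ m : Fin n → ℤ in Filter.cofinite, m ≠ 0 :=
    (Set.finite_singleton (0 : Fin n → ℤ)).eventually_cofinite_notMem
  filter_upwards [hfin] with m hm
  have hm0 : intVec m ≠ 0 := by
    intro h
    refine hm (funext fun i => ?_)
    have := congrArg (fun v : Rn n => v i) h
    simpa [intVec] using this
  have hL0 : 0 < ‖L (intVec m)‖ := norm_pos_iff.2 (by simpa using hm0)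
  have hle : ‖L (intVec m)‖ ≤ ‖(L : Rn n →L[ℝ] Rn n)‖ * (1 + ‖intVec m‖) :=
    ((L : Rn n →L[ℝ] Rn n).le_opNorm _).trans
      (mul_le_mul_of_nonneg_left (by linarith) (norm_nonneg _))
  have hpow := pow_le_pow_left₀ hL0.le hle (n + 1)
  rw [mul_pow] at hpow
  have e1 : ((fun z : Λ => ‖z‖⁻¹ ^ (n + 1)) ∘ e) m = (‖L (intVec m)‖ ^ (n + 1))⁻¹ := by
    simp only [Function.comp_apply, ← he, inv_pow]
    rfl
  rw [e1, Real.norm_of_nonneg (by positivity), ← div_eq_mul_inv, inv_eq_one_div,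
    div_le_div_iff₀ (by positivity) (by positivity), one_mul]
  exact hpow

/-- The Fourier transforms of a continuous compactly supported family of Schwartz functions decay
rapidly, uniformly in the parameter. -/
theorem exists_fourier_decay {Qs : Rn n → 𝓢(Rn n, ℂ)} (hQ : Continuous Qs)
    (hc : HasCompactSupport Qs) (N : ℕ) :
    ∃ C : ℝ, 0 ≤ C ∧ ∀ y w, ‖𝓕 (Qs y) w‖ * (1 + ‖w‖) ^ N ≤ C := by
  have hF : Continuous fun y => 𝓕 (Qs y) :=
    (FourierTransform.fourierCLM ℂ 𝓢(Rn n, ℂ)).continuous.comp hQ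
  have hFc : HasCompactSupport fun y => 𝓕 (Qs y) :=
    hc.comp_left (g := fun f : 𝓢(Rn n, ℂ) => 𝓕 f)
      (map_zero (FourierTransform.fourierCLM ℂ 𝓢(Rn n, ℂ)))
  have hp : ∀ k, ∃ C : ℝ, ∀ y, SchwartzMap.seminorm ℝ k 0 (𝓕 (Qs y)) ≤ C := by
    intro k
    have hcont : Continuous fun y => SchwartzMap.seminorm ℝ k 0 (𝓕 (Qs y)) :=
      ((schwartz_withSeminorms ℝ (Rn n) ℂ).continuous_seminorm (k, 0)).comp hF
    obtain ⟨C, hC⟩ := (hFc.comp_left (g := fun f => SchwartzMap.seminorm ℝ k 0 f)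
      (map_zero _)).exists_bound_of_continuous hcont
    exact ⟨C, fun y => (le_abs_self _).trans (hC y)⟩
  obtain ⟨C₀, h₀⟩ := hp 0
  obtain ⟨C₁, h₁⟩ := hp N
  have hC₀ : 0 ≤ C₀ := (apply_nonneg _ _).trans (h₀ 0)
  have hC₁ : 0 ≤ C₁ := (apply_nonneg _ _).trans (h₁ 0)
  refine ⟨2 ^ (N - 1) * (C₀ + C₁), by positivity, fun y w => ?_⟩
  have hw := add_pow_le zero_le_one (norm_nonneg w) N
  have e₀ := (SchwartzMap.norm_pow_mul_le_seminorm ℝ (𝓕 (Qs y)) 0 w).trans (h₀ y)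
  have e₁ := (SchwartzMap.norm_pow_mul_le_seminorm ℝ (𝓕 (Qs y)) N w).trans (h₁ y)
  rw [pow_zero, one_mul] at e₀
  calc ‖𝓕 (Qs y) w‖ * (1 + ‖w‖) ^ N
      ≤ ‖𝓕 (Qs y) w‖ * (2 ^ (N - 1) * (1 ^ N + ‖w‖ ^ N)) :=
        mul_le_mul_of_nonneg_left hw (norm_nonneg _)
    _ = 2 ^ (N - 1) * (‖𝓕 (Qs y) w‖ + ‖w‖ ^ N * ‖𝓕 (Qs y) w‖) := by rw [one_pow]; ring
    _ ≤ _ := mul_le_mul_of_nonneg_left (add_le_add e₀ e₁) (by positivity)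

/-- Only finitely many translates along a lattice of a compactly supported function meet a given
ball. -/
theorem finite_setOf_lattice_translate_ne_zero (Λ : Submodule ℤ (Rn n)) [DiscreteTopology Λ]
    {f : Rn n → ℂ} (hc : HasCompactSupport f) (R : ℝ) :
    {l : Λ | ∃ t : Rn n, ‖t‖ ≤ R ∧ f (t - l) ≠ 0}.Finite := by
  obtain ⟨S, -, hS⟩ := exists_norm_le_of_hasCompactSupport hc
  have hfin : ((Λ : Set (Rn n)) ∩ Metric.closedBall 0 (R + S)).Finite := by
    rw [Set.inter_comm]
    refine Metric.finite_isBounded_inter_isClosed ?_ Metric.isBounded_closedBall ?_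
    · exact isDiscrete_iff_discreteTopology.2 ‹_›
    · exact (AddSubgroup.isClosed_of_discrete (H := Λ.toAddSubgroup))
  refine (hfin.preimage (f := ((↑) : Λ → Rn n)) Subtype.val_injective.injOn).subset ?_
  rintro l ⟨t, ht, hl⟩
  refine ⟨l.2, ?_⟩
  have h1 := hS _ hl
  have h2 : ‖(l : Rn n)‖ ≤ ‖t‖ + ‖t - l‖ := by
    have := norm_sub_le t (t - l)
    rwa [sub_sub_cancel] at this
  simp only [Metric.mem_closedBall, dist_zero_right]
  linarith

end Lattice

/-! ### Norm bounds for the frame operator -/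

section Kernel

open scoped FourierTransform

variable {n : ℕ} {E : Type u} [NormedAddCommGroup E] [NormedSpace ℂ E]
  {ι : E →L[ℂ] 𝓢'(Rn n, ℂ)} {j : 𝓢(Rn n, ℂ) →L[ℂ] E}

theorem norm_le_of_sub_le {V : Type*} [NormedAddCommGroup V] {a b : V} {r s : ℝ} (ha : ‖a‖ ≤ r)
    (hb : ‖b‖ ≤ s) {c : V} (h : c = a - b) : ‖c‖ ≤ r + s := by
  rw [h]
  exact (norm_sub_le _ _).trans (add_le_add ha hb)

/-- For fixed `y` the function `H` is the product of the translate `g (· - y)` with a character and a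
`Λ`-periodic function. The Fourier series of the latter writes `H` as a sum of time-frequency shifts
of `g` with rapidly decreasing coefficients, which gives a bound uniform in `y` and in `g`. -/
theorem exists_norm_slice_le (hι : IsTMIB ι)
    (hj : ∀ φ, ι (j φ) = SchwartzMap.toTemperedDistributionCLM (Rn n) ℂ volume φ)
    (B : Matrix (Fin n) (Fin n) ℝ)
    (Λ : Submodule ℤ (Rn n)) [DiscreteTopology Λ] [IsZLattice ℝ Λ]
    {ψ χ : Rn n → ℂ} (hψ : ContDiff ℝ ∞ ψ) (hψc : HasCompactSupport ψ)
    (hχ : ContDiff ℝ ∞ χ) (hχc : HasCompactSupport χ) :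
    ∃ C : ℝ, 0 ≤ C ∧ ∀ (y : Rn n) (g H : 𝓢(Rn n, ℂ)),
      (∀ t, H t = ∑ᶠ l : Λ, ψ (t - y - l) * χ (t - l) *
        character (-(Matrix.toEuclideanLin B l)) y * g (t - y)) → ‖j H‖ ≤ C * ‖j g‖ := by
  have := hι.complete
  obtain ⟨L, e, he⟩ := exists_lattice_equiv Λ
  let T : Rn n →L[ℝ] Rn n := (Matrix.toEuclideanLin B).toContinuousLinearMap
  let T' := ContinuousLinearMap.adjoint T
  let S := ContinuousLinearMap.adjoint (L.symm : Rn n →L[ℝ] Rn n)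
  obtain ⟨Rψ, hRψ0, hRψ⟩ := exists_norm_le_of_hasCompactSupport hψc
  obtain ⟨Rχ, hRχ0, hRχ⟩ := exists_norm_le_of_hasCompactSupport hχc
  let R := Rχ + Rψ
  have hR0 : 0 ≤ R := add_nonneg hRχ0 hRψ0
  -- In lattice coordinates `x = L⁻¹ t`, the function whose periodization over `ℤⁿ` is needed.
  let G : Rn n × Rn n → ℂ := fun q => ψ (L q.2 - q.1) * χ (L q.2) * character (T (L q.2)) q.1
  have hG : ContDiff ℝ ∞ G := by
    have h1 : ContDiff ℝ ∞ fun q : Rn n × Rn n => L q.2 := by fun_prop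
    refine ((hψ.comp (h1.sub contDiff_fst)).mul (hχ.comp h1)).mul ?_
    exact contDiff_character (T.contDiff.comp h1) contDiff_fst
  have hGR : ∀ q : Rn n × Rn n, G q ≠ 0 →
      ‖q.1‖ ≤ R ∧ ‖q.2‖ ≤ ‖(L.symm : Rn n →L[ℝ] Rn n)‖ * Rχ := by
    intro q hq
    have h1 := hRψ _ (left_ne_zero_of_mul (left_ne_zero_of_mul hq))
    have h2 := hRχ _ (right_ne_zero_of_mul (left_ne_zero_of_mul hq))
    refine ⟨norm_le_of_sub_le h2 h1 (by abel), ?_⟩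
    have h3 := (L.symm : Rn n →L[ℝ] Rn n).le_opNorm (L q.2)
    simp only [ContinuousLinearEquiv.coe_coe, ContinuousLinearEquiv.symm_apply_apply] at h3
    exact h3.trans (mul_le_mul_of_nonneg_left h2 (norm_nonneg _))
  have hGc : HasCompactSupport G :=
    hasCompactSupport_of_forall_norm_le (max R (‖(L.symm : Rn n →L[ℝ] Rn n)‖ * Rχ)) fun q hq =>
      max_le_max (hGR q hq).1 (hGR q hq).2
  have hsc : ∀ y, HasCompactSupport fun x => G (y, x) := fun y =>
    hasCompactSupport_of_forall_norm_le _ fun x hx => (hGR (y, x) hx).2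
  have hss : ∀ y, ContDiff ℝ ∞ fun x => G (y, x) := fun y => hG.comp (contDiff_prodMk_right y)
  let Qs : Rn n → 𝓢(Rn n, ℂ) := fun y => (hsc y).toSchwartzMap (hss y)
  have hQs : ∀ y x, Qs y x = G (y, x) := fun y x => rfl
  have hQcont : Continuous Qs := continuous_schwartz_of_contDiff hG hGc hQs
  have hQc : HasCompactSupport Qs := by
    refine HasCompactSupport.intro (isCompact_closedBall 0 R) fun y hy => ?_
    ext x
    rw [hQs]
    by_contra h0
    exact hy (by simpa using (hGR _ h0).1)
  obtain ⟨τ, hτ, σ, hσ, C, hC, hshift⟩ := hι.exists_norm_shift_le hj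
  -- `⌈σ⌉` powers absorb the growth of the modulations, the other `n + 1` ensure summability.
  obtain ⟨CN, hCN, hdecay⟩ := exists_fourier_decay hQcont hQc (⌈σ⌉₊ + (n + 1))
  let D : ℝ := 1 + ‖S‖ + ‖T'‖ * R
  have hD0 : 0 ≤ D := by positivity
  let M : ℝ := CN * (C * (1 + R) ^ τ * D ^ σ)
  refine ⟨M * ∑' m : Fin n → ℤ, ((1 + ‖intVec m‖) ^ (n + 1))⁻¹, by positivity, ?_⟩
  intro y g H hH
  by_cases hy : ‖y‖ ≤ R
  swap
  -- Beyond `R` the supports of `ψ (· - y)` and `χ` are disjoint.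
  · have hzero : H = 0 := by
      ext t
      rw [hH]
      refine (finsum_congr fun l => ?_).trans finsum_zero
      by_contra h0
      have h1 := left_ne_zero_of_mul (left_ne_zero_of_mul h0)
      exact hy (norm_le_of_sub_le (hRχ _ (right_ne_zero_of_mul h1))
        (hRψ _ (left_ne_zero_of_mul h1)) (by abel))
    rw [hzero, map_zero, norm_zero]
    positivity
  let ξ : (Fin n → ℤ) → Rn n := fun m => S (intVec m) - T' y
  let gy : 𝓢(Rn n, ℂ) := SchwartzMap.compSubConstCLM ℂ y g
  have hgy : ∀ t, gy t = g (t - y) := fun t => by simp [gy]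
  let fs : (Fin n → ℤ) → 𝓢(Rn n, ℂ) := fun m => SchwartzMap.smulLeftCLM ℂ (character (ξ m)) gy
  have hfs : ∀ m t, fs m t = character (ξ m) t * gy t := fun m t => by
    simp only [fs]
    rw [SchwartzMap.smulLeftCLM_apply_apply (character_hasTemperateGrowth _), smul_eq_mul]
  let a : (Fin n → ℤ) → ℂ := fun m => 𝓕 (Qs y) (intVec m)
  have hpos : ∀ m : Fin n → ℤ, 0 < 1 + ‖intVec m‖ := fun m => by positivity
  have hone : ∀ m : Fin n → ℤ, 1 ≤ 1 + ‖intVec m‖ := fun m => by simp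
  have haN : ∀ m, ‖a m‖ * (1 + ‖intVec m‖) ^ ⌈σ⌉₊ ≤ CN * ((1 + ‖intVec m‖) ^ (n + 1))⁻¹ := by
    intro m
    rw [← div_eq_mul_inv, le_div_iff₀ (pow_pos (hpos m) _), mul_assoc, ← pow_add]
    exact hdecay y _
  have ha' : ∀ m, ‖a m‖ ≤ CN * ((1 + ‖intVec m‖) ^ (n + 1))⁻¹ := fun m =>
    (le_mul_of_one_le_right (norm_nonneg _) (one_le_pow₀ (hone m))).trans (haN m)
  have ha : Summable fun m => ‖a m‖ :=
    Summable.of_nonneg_of_le (fun _ => norm_nonneg _) ha'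
      (summable_one_add_norm_intVec_inv.mul_left CN)
  have hξ : ∀ m, 1 + ‖ξ m‖ ≤ D * (1 + ‖intVec m‖) := by
    intro m
    have h1 : ‖ξ m‖ ≤ ‖S‖ * ‖intVec m‖ + ‖T'‖ * R := (norm_sub_le _ _).trans
      (add_le_add (S.le_opNorm _)
        ((T'.le_opNorm _).trans (mul_le_mul_of_nonneg_left hy (norm_nonneg _))))
    have h2 : 0 ≤ ‖intVec m‖ := norm_nonneg _
    have h3 : 0 ≤ ‖T'‖ * R * ‖intVec m‖ := by positivity
    have h4 := norm_nonneg S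
    simp only [D]
    nlinarith
  have hab : ∀ m, ‖a m‖ * ‖j (fs m)‖ ≤ M * ((1 + ‖intVec m‖) ^ (n + 1))⁻¹ * ‖j g‖ := by
    intro m
    have h1 : ‖j (fs m)‖ ≤ C * (1 + ‖y‖) ^ τ * (1 + ‖ξ m‖) ^ σ * ‖j g‖ :=
      hshift y (ξ m) g (fs m) fun t => by rw [hfs, hgy]
    have h2 : (1 + ‖ξ m‖) ^ σ ≤ D ^ σ * (1 + ‖intVec m‖) ^ ⌈σ⌉₊ := by
      refine (Real.rpow_le_rpow (by positivity) (hξ m) hσ.le).trans ?_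
      rw [Real.mul_rpow hD0 (hpos m).le, ← Real.rpow_natCast]
      exact mul_le_mul_of_nonneg_left
        (Real.rpow_le_rpow_of_exponent_le (hone m) (Nat.le_ceil σ)) (by positivity)
    have h3 : (1 + ‖y‖) ^ τ ≤ (1 + R) ^ τ :=
      Real.rpow_le_rpow (by positivity) (by linarith) hτ.le
    calc ‖a m‖ * ‖j (fs m)‖
        ≤ ‖a m‖ * (C * (1 + R) ^ τ * (D ^ σ * (1 + ‖intVec m‖) ^ ⌈σ⌉₊) * ‖j g‖) := by
          refine mul_le_mul_of_nonneg_left (h1.trans ?_) (norm_nonneg _)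
          gcongr
      _ = ‖a m‖ * (1 + ‖intVec m‖) ^ ⌈σ⌉₊ * (C * (1 + R) ^ τ * D ^ σ * ‖j g‖) := by ring
      _ ≤ CN * ((1 + ‖intVec m‖) ^ (n + 1))⁻¹ * (C * (1 + R) ^ τ * D ^ σ * ‖j g‖) :=
          mul_le_mul_of_nonneg_right (haN m) (by positivity)
      _ = M * ((1 + ‖intVec m‖) ^ (n + 1))⁻¹ * ‖j g‖ := by simp only [M]; ring
  have hsum : ∀ t, HasSum (fun m => a m * (character (ξ m) t * gy t)) (H t) := by
    intro t
    have hP := hasSum_fourier_intVec (Qs y).continuous (hsc y)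
      (by simpa only [a, SchwartzMap.fourier_coe] using ha.of_norm) (L.symm t)
    have hP' := hP.mul_right (character (-(T' y)) t * gy t)
    have e₁ : (fun m => a m * (character (ξ m) t * gy t)) = fun m => 𝓕 (Qs y : Rn n → ℂ) (intVec m) *
        character (intVec m) (L.symm t) * (character (-(T' y)) t * gy t) := by
      ext m
      rw [← character_mul_character (ξ := intVec m) (s := L.symm t) (η := -(T' y)) (t := t)]
      · simp only [a, SchwartzMap.fourier_coe]
        ring
      · simp only [ξ, S, inner_sub_right, inner_neg_right,
          ContinuousLinearMap.adjoint_inner_right, ContinuousLinearEquiv.coe_coe]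
        ring
    have e₂ : H t = (∑ᶠ k : Fin n → ℤ, Qs y (L.symm t + intVec k)) *
        (character (-(T' y)) t * gy t) := by
      rw [hH, finsum_mul, ← finsum_comp_equiv (e.trans (Equiv.neg Λ))]
      refine finsum_congr fun k => ?_
      have hk : L (L.symm t + intVec k) = t + e k := by rw [map_add, he]; simp
      have hc : character (T (t + e k)) y * character (-(T' y)) t =
          character (-(Matrix.toEuclideanLin B ((-(e k) : Λ) : Rn n))) y := by
        refine character_mul_character ?_
        have : Matrix.toEuclideanLin B ((-(e k) : Λ) : Rn n) = -(T (e k)) := by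
          rw [Submodule.coe_neg, map_neg]; rfl
        rw [this]
        simp only [T', inner_neg_right, ContinuousLinearMap.adjoint_inner_right, map_add,
          inner_add_right, neg_neg]
        rw [real_inner_comm y (T t)]
        ring
      -- `B t · y = B l · y + B (t - l) · y` separates the dependence of the phase on `l`.
      simp only [Equiv.trans_apply, Equiv.neg_apply]
      rw [← hc, hQs, hgy]
      simp only [G, hk, Submodule.coe_neg, sub_neg_eq_add]
      rw [sub_add_eq_add_sub]
      ring
    rw [e₁, e₂]
    exact hP'
  have hfin := norm_le_tsum_of_hasSum hι.injective hj hfs ha hsum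
    ((summable_one_add_norm_intVec_inv.mul_left M).mul_right ‖j g‖) hab
  rwa [tsum_mul_right, tsum_mul_left] at hfin

/-- The frame operator is an integral of the slices bounded in `exists_norm_slice_le`: the
substitution `s = t - y` in its kernel gives `h t = ∫ G (y, t) dy`, where `G` vanishes for `y` outside
of a ball that does not depend on `g`. -/
theorem exists_norm_kernel_le (hι : IsTMIB ι)
    (hj : ∀ φ, ι (j φ) = SchwartzMap.toTemperedDistributionCLM (Rn n) ℂ volume φ)
    (B : Matrix (Fin n) (Fin n) ℝ)
    (Λ : Submodule ℤ (Rn n)) [DiscreteTopology Λ] [IsZLattice ℝ Λ]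
    {ψ χ : Rn n → ℂ} (hψ : ContDiff ℝ ∞ ψ) (hψc : HasCompactSupport ψ)
    (hχ : ContDiff ℝ ∞ χ) (hχc : HasCompactSupport χ) :
    ∃ C : ℝ, 0 ≤ C ∧ ∀ g h : 𝓢(Rn n, ℂ), HasCompactSupport g →
      (∀ t, h t = ∑ᶠ l : Λ, (∫ s, g s * twistedTranslation (-B) l ψ s) *
        twistedTranslation B l χ t) → ‖j h‖ ≤ C * ‖j g‖ := by
  have := hι.complete
  obtain ⟨C, hC, hslice⟩ := exists_norm_slice_le hι hj B Λ hψ hψc hχ hχc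
  obtain ⟨Rψ, hRψ0, hRψ⟩ := exists_norm_le_of_hasCompactSupport hψc
  obtain ⟨Rχ, hRχ0, hRχ⟩ := exists_norm_le_of_hasCompactSupport hχc
  let K : Set (Rn n) := Metric.closedBall 0 (Rχ + Rψ)
  refine ⟨C * volume.real K, by positivity, fun g h hg hh => ?_⟩
  obtain ⟨Rg, -, hRg⟩ := exists_norm_le_of_hasCompactSupport hg
  have hfin := finite_setOf_lattice_translate_ne_zero Λ hψc Rg
  let term : Λ → Rn n × Rn n → ℂ := fun l q => ψ (q.2 - q.1 - l) * χ (q.2 - l) *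
        character (-(Matrix.toEuclideanLin B l)) q.1 * g (q.2 - q.1)
  have hterm : ∀ l q, term l q ≠ 0 → l ∈ hfin.toFinset ∧ ‖q.1‖ ≤ Rχ + Rψ ∧
      ‖q.2‖ ≤ Rχ + Rψ + Rg := by
    intro l q hq
    have h1 := left_ne_zero_of_mul (left_ne_zero_of_mul hq)
    have h2 := hRψ _ (left_ne_zero_of_mul h1)
    have h3 := hRχ _ (right_ne_zero_of_mul h1)
    have h4 := hRg _ (right_ne_zero_of_mul hq)
    have h5 : ‖q.1‖ ≤ Rχ + Rψ := norm_le_of_sub_le h3 h2 (by abel)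
    refine ⟨hfin.mem_toFinset.2 ⟨_, h4, left_ne_zero_of_mul h1⟩, h5, ?_⟩
    exact norm_le_of_sub_le h5 (b := -(q.2 - q.1)) (by rwa [norm_neg]) (by abel)
  have hsmooth : ∀ l, ContDiff ℝ ∞ (term l) := by
    intro l
    have hsub : ContDiff ℝ ∞ fun q : Rn n × Rn n => q.2 - q.1 := contDiff_snd.sub contDiff_fst
    refine (((hψ.comp (hsub.sub contDiff_const)).mul
      (hχ.comp (contDiff_snd.sub contDiff_const))).mul ?_).mul ((g.smooth ⊤).comp hsub)
    exact contDiff_character contDiff_const contDiff_fst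
  let G : Rn n × Rn n → ℂ := fun q => ∑ l ∈ hfin.toFinset, term l q
  have hG : ContDiff ℝ ∞ G := ContDiff.sum fun l _ => hsmooth l
  have hGR : ∀ q, G q ≠ 0 → ‖q.1‖ ≤ Rχ + Rψ ∧ ‖q.2‖ ≤ Rχ + Rψ + Rg := by
    intro q hq
    obtain ⟨l, -, hl⟩ := Finset.exists_ne_zero_of_sum_ne_zero hq
    exact (hterm l q hl).2
  have hGc : HasCompactSupport G := hasCompactSupport_of_forall_norm_le _ fun q hq =>
    max_le_max (hGR q hq).1 (hGR q hq).2
  have hsc : ∀ y, HasCompactSupport fun x => G (y, x) := fun y =>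
    hasCompactSupport_of_forall_norm_le _ fun x hx => (hGR (y, x) hx).2
  let Gs : Rn n → 𝓢(Rn n, ℂ) := fun y =>
    (hsc y).toSchwartzMap (hG.comp (contDiff_prodMk_right y))
  have hGs : ∀ y t, Gs y t = G (y, t) := fun y t => rfl
  have hint : ∀ t, h t = ∫ y, G (y, t) := by
    intro t
    simp only [G]
    rw [integral_finsetSum, hh, finsum_eq_finsetSum_of_support_subset (s := hfin.toFinset)]
    · refine Finset.sum_congr rfl fun l _ => ?_
      rw [← integral_sub_left_eq_self _ volume t, ← integral_mul_const]
      refine integral_congr_ae (Filter.Eventually.of_forall fun s => ?_)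
      simp only [term, twistedTranslation_eq]
      rw [← character_mul_character (ξ := -(Matrix.toEuclideanLin B l)) (s := t - l)
        (η := -(Matrix.toEuclideanLin (-B) l)) (t := t - s - l) (r := s)]
      · ring
      · simp only [map_neg, LinearMap.neg_apply, neg_neg, inner_neg_right, inner_sub_left]
        ring
    · intro l hl
      obtain ⟨s, hs⟩ : ∃ s, g s * twistedTranslation (-B) l ψ s ≠ 0 := by
        by_contra! h0
        exact hl (by simp [h0])
      rw [twistedTranslation_eq] at hs
      rw [Set.Finite.coe_toFinset]
      exact ⟨s, hRg _ (left_ne_zero_of_mul hs),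
        left_ne_zero_of_mul (right_ne_zero_of_mul hs)⟩
    · intro l _
      refine ((hsmooth l).comp (contDiff_prodMk_left t)).continuous.integrable_of_hasCompactSupport
        (hasCompactSupport_of_forall_norm_le _ fun y hy => (hterm l (y, t) hy).2.1)
  have hbound : ∀ y, ‖j (Gs y)‖ ≤ C * ‖j g‖ := by
    intro y
    refine hslice y g (Gs y) fun t => ?_
    rw [hGs, finsum_eq_finsetSum_of_support_subset (s := hfin.toFinset)]
    intro l hl
    exact (hterm l (y, t) hl).1
  have hzero : ∀ y, y ∉ K → j (Gs y) = 0 := by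
    intro y hy
    have : Gs y = 0 := by
      ext t
      rw [hGs]
      by_contra h0
      exact hy (by simpa [K] using (hGR _ h0).1)
    rw [this, map_zero]
  rw [← integral_of_contDiff hι.injective hj hG hGc hGs hint,
    ← setIntegral_eq_integral_of_forall_compl_eq_zero hzero]
  refine (norm_setIntegral_le_of_norm_le_const
    (measure_closedBall_lt_top) fun y _ => hbound y).trans (le_of_eq ?_)
  ring

end Kernel

/-! ### Twisted translates and their biorthogonality -/

section Twisted

variable {n : ℕ} {B : Matrix (Fin n) (Fin n) ℝ} {f χ ψ : Rn n → ℂ}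

theorem contDiff_twistedTranslation (hf : ContDiff ℝ ∞ f) (x : Rn n) :
    ContDiff ℝ ∞ (twistedTranslation B x f) := by
  have h : ContDiff ℝ ∞ fun t : Rn n => t - x := contDiff_id.sub contDiff_const
  rw [funext (twistedTranslation_eq B x f)]
  exact (hf.comp h).mul (contDiff_character contDiff_const h)

theorem twistedTranslation_ne_zero {x t : Rn n} (h : twistedTranslation B x f t ≠ 0) :
    f (t - x) ≠ 0 :=
  left_ne_zero_of_mul h

theorem hasCompactSupport_twistedTranslation (hf : HasCompactSupport f) (x : Rn n) :
    HasCompactSupport (twistedTranslation B x f) := by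
  obtain ⟨R, -, hR⟩ := exists_norm_le_of_hasCompactSupport hf
  refine hasCompactSupport_of_forall_norm_le (R + ‖x‖) fun t ht => ?_
  exact norm_le_of_sub_le (hR _ (twistedTranslation_ne_zero ht)) (norm_neg x).le (by abel)

variable (B) in
/-- The twisted translate of a smooth function of compact support, as a Schwartz function. -/
noncomputable def twistedSchwartz (hf : ContDiff ℝ ∞ f) (hfc : HasCompactSupport f) (x : Rn n) :
    𝓢(Rn n, ℂ) :=
  (hasCompactSupport_twistedTranslation (B := B) hfc x).toSchwartzMap
    (contDiff_twistedTranslation hf x)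

theorem twistedSchwartz_apply (hf : ContDiff ℝ ∞ f) (hfc : HasCompactSupport f) (x t : Rn n) :
    twistedSchwartz B hf hfc x t = twistedTranslation B x f t := rfl

theorem hasCompactSupport_twistedSchwartz (hf : ContDiff ℝ ∞ f) (hfc : HasCompactSupport f)
    (x : Rn n) : HasCompactSupport (twistedSchwartz B hf hfc x) :=
  hasCompactSupport_twistedTranslation (B := B) hfc x

theorem finite_setOf_integral_twistedTranslation_ne_zero
    (Λ : Submodule ℤ (Rn n)) [DiscreteTopology Λ] (hf : HasCompactSupport f) {φ : Rn n → ℂ}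
    (hφ : HasCompactSupport φ) :
    {l : Λ | ∫ t, twistedTranslation B l f t * φ t ≠ 0}.Finite := by
  obtain ⟨R, -, hR⟩ := exists_norm_le_of_hasCompactSupport hφ
  refine (finite_setOf_lattice_translate_ne_zero Λ hf R).subset fun l hl => ?_
  obtain ⟨t, ht⟩ : ∃ t, twistedTranslation B l f t * φ t ≠ 0 := by
    by_contra! h0
    exact hl (by simp [h0])
  exact ⟨t, hR t (right_ne_zero_of_mul ht), twistedTranslation_ne_zero (left_ne_zero_of_mul ht)⟩

/-- The synthesized function acts on compactly supported functions by a finite sum. -/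
theorem integral_synthesis_mul (Λ : Submodule ℤ (Rn n)) [DiscreteTopology Λ]
    (hχ : ContDiff ℝ ∞ χ) (hχc : HasCompactSupport χ) (c : Λ → ℂ) (φ : 𝓢(Rn n, ℂ))
    (hφ : HasCompactSupport φ) :
    ∫ t, synthesis B Λ χ c t * φ t =
      ∑ᶠ l : Λ, c l * ∫ t, twistedTranslation B l χ t * φ t := by
  obtain ⟨R, -, hR⟩ := exists_norm_le_of_hasCompactSupport hφ
  have hfin := finite_setOf_lattice_translate_ne_zero Λ hχc R
  have hpt : ∀ t, synthesis B Λ χ c t * φ t =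
      ∑ l ∈ hfin.toFinset, c l * (twistedTranslation B l χ t * φ t) := by
    intro t
    rw [synthesis, finsum_mul]
    simp only [mul_assoc]
    refine finsum_eq_finsetSum_of_support_subset _ fun l hl => ?_
    rw [Set.Finite.coe_toFinset]
    have h1 := right_ne_zero_of_mul hl
    exact ⟨t, hR t (right_ne_zero_of_mul h1), twistedTranslation_ne_zero (left_ne_zero_of_mul h1)⟩
  simp only [hpt]
  rw [integral_finsetSum]
  · simp only [integral_const_mul]
    refine (finsum_eq_finsetSum_of_support_subset _ fun l hl => ?_).symm
    rw [Set.Finite.coe_toFinset]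
    obtain ⟨t, ht⟩ : ∃ t, twistedTranslation B l χ t * φ t ≠ 0 := by
      by_contra! h0
      exact hl (by simp [h0])
    exact ⟨t, hR t (right_ne_zero_of_mul ht), twistedTranslation_ne_zero (left_ne_zero_of_mul ht)⟩
  · intro l _
    refine Integrable.const_mul ?_ _
    exact ((contDiff_twistedTranslation hχ _).continuous.mul
      φ.continuous).integrable_of_hasCompactSupport hφ.mul_left

/-- The systems `T^B_l χ` and `T^{-B}_l ψ` are biorthogonal up to the factor `∫ χ ψ`. -/
theorem integral_twistedTranslation_mul (Λ : Submodule ℤ (Rn n)) {U : Set (Rn n)}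
    (hU : Pairwise fun l m : Λ => Disjoint ((fun t => (l : Rn n) + t) '' U)
        ((fun t => (m : Rn n) + t) '' U))
    (hχ : Function.support χ ⊆ U) (hψ : Function.support ψ ⊆ U) (l m : Λ) [Decidable (l = m)] :
    ∫ t, twistedTranslation B l χ t * twistedTranslation (-B) m ψ t =
      if l = m then ∫ t, χ t * ψ t else 0 := by
  split_ifs with h
  · subst h
    rw [← integral_sub_right_eq_self (fun t => χ t * ψ t) (l : Rn n)]
    refine integral_congr_ae (Filter.Eventually.of_forall fun t => ?_)
    simp only [twistedTranslation_eq]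
    have := character_mul_character (ξ := -(Matrix.toEuclideanLin B l))
      (η := -(Matrix.toEuclideanLin (-B) l)) (s := t - l) (t := t - l) (ζ := 0) (r := 0)
      (by simp)
    have h0 : character (0 : Rn n) 0 = 1 := by simp [character]
    rw [h0] at this
    linear_combination (χ (t - l) * ψ (t - l)) * this
  · refine (integral_congr_ae (Filter.Eventually.of_forall fun t => ?_)).trans
      (integral_zero _ _)
    by_contra h0
    have h1 := hχ (twistedTranslation_ne_zero (left_ne_zero_of_mul h0))
    have h2 := hψ (twistedTranslation_ne_zero (right_ne_zero_of_mul h0))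
    exact Set.disjoint_left.1 (hU h) ⟨t - l, h1, add_sub_cancel _ t⟩
      ⟨t - m, h2, add_sub_cancel _ t⟩

/-- A nonzero smooth function of compact support has a dual function with the same support. -/
theorem exists_dual_function (hχ : ContDiff ℝ ∞ χ) (hχc : HasCompactSupport χ) (h0 : χ ≠ 0) :
    ∃ ψ : Rn n → ℂ, ContDiff ℝ ∞ ψ ∧ HasCompactSupport ψ ∧
      Function.support ψ ⊆ Function.support χ ∧ ∫ t, χ t * ψ t = 1 := by
  let κ : ℝ := ∫ t, ‖χ t‖ ^ 2
  have hκ : κ ≠ 0 := by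
    obtain ⟨t₀, ht₀⟩ := Function.ne_iff.1 h0
    refine (Continuous.integral_pos_of_hasCompactSupport_nonneg_nonzero (x := t₀)
      (f := fun t => ‖χ t‖ ^ 2) (hχ.continuous.norm.pow 2) ?_ (fun t => sq_nonneg _) ?_).ne'
    · exact hχc.comp_left (g := fun z : ℂ => ‖z‖ ^ 2) (by simp)
    · exact pow_ne_zero 2 (norm_ne_zero_iff.2 ht₀)
  refine ⟨fun t => (κ : ℂ)⁻¹ * (starRingEnd ℂ) (χ t), ?_, ?_, ?_, ?_⟩
  · exact contDiff_const.mul (Complex.conjCLE.contDiff.comp hχ)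
  · exact hχc.comp_left (g := fun z : ℂ => (κ : ℂ)⁻¹ * (starRingEnd ℂ) z) (by simp)
  · intro t ht ht'
    exact ht (by simp [ht'])
  · have : ∀ t, χ t * ((κ : ℂ)⁻¹ * (starRingEnd ℂ) (χ t)) =
        (κ : ℂ)⁻¹ * ((‖χ t‖ ^ 2 : ℝ) : ℂ) := by
      intro t
      rw [mul_left_comm, Complex.mul_conj, Complex.normSq_eq_norm_sq]
    simp only [this]
    rw [integral_const_mul, integral_complex_ofReal]
    exact inv_mul_cancel₀ (by exact_mod_cast hκ)

end Twisted

/-! ### The frame operator on TMIBs and DTMIBs -/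

section Transfer

variable {n : ℕ} {E : Type u} [NormedAddCommGroup E] [NormedSpace ℂ E]
  {ι : E →L[ℂ] 𝓢'(Rn n, ℂ)} {j : 𝓢(Rn n, ℂ) →L[ℂ] E}
  (B : Matrix (Fin n) (Fin n) ℝ) (Λ : Submodule ℤ (Rn n)) [DiscreteTopology Λ] [IsZLattice ℝ Λ]
  {ψ χ : Rn n → ℂ}

/-- The frame operator `g ↦ ∑ ⟨g, T^{-B}_l ψ⟩ T^B_l χ` is bounded on a TMIB. -/
theorem IsTMIB.exists_frameOperator (hι : IsTMIB ι) (hd : DenseRange j)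
    (hj : ∀ φ, ι (j φ) = SchwartzMap.toTemperedDistributionCLM (Rn n) ℂ volume φ)
    (hψ : ContDiff ℝ ∞ ψ) (hψc : HasCompactSupport ψ)
    (hχ : ContDiff ℝ ∞ χ) (hχc : HasCompactSupport χ) :
    ∃ A : E →L[ℂ] E, ∀ g : 𝓢(Rn n, ℂ), HasCompactSupport g →
      A (j g) = ∑ᶠ l : Λ, (∫ t, twistedTranslation (-B) l ψ t * g t) •
        j (twistedSchwartz B hχ hχc l) := by
  have := hι.complete
  obtain ⟨C, hC, hbound⟩ := exists_norm_kernel_le hι hj B Λ hψ hψc hχ hχc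
  let a : Λ → 𝓢(Rn n, ℂ) → ℂ := fun l g => ∫ t, twistedTranslation (-B) l ψ t * g t
  have hfin : ∀ g : compactSchwartz (Rn n), (Function.support fun l => a l g).Finite := fun g =>
    finite_setOf_integral_twistedTranslation_ne_zero Λ hψc g.2
  have hfin' : ∀ g : compactSchwartz (Rn n),
      (Function.support fun l => a l g • j (twistedSchwartz B hχ hχc l)).Finite := fun g =>
    (hfin g).subset fun l hl hl' => hl (by
      have h0 : a l g = 0 := hl'
      simp only [h0, zero_smul])
  have hint : ∀ (l : Λ) (g : 𝓢(Rn n, ℂ)),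
      Integrable fun t => twistedTranslation (-B) l ψ t * g t := fun l g =>
    ((contDiff_twistedTranslation hψ _).continuous.mul
      g.continuous).integrable_of_hasCompactSupport
        (hasCompactSupport_twistedTranslation hψc _).mul_right
  let e : compactSchwartz (Rn n) →ₗ[ℂ] E := j.toLinearMap ∘ₗ (compactSchwartz (Rn n)).subtype
  let f : compactSchwartz (Rn n) →ₗ[ℂ] E :=
    { toFun := fun g => ∑ᶠ l : Λ, a l g • j (twistedSchwartz B hχ hχc l)
      map_add' := fun g₁ g₂ => by
        rw [← finsum_add_distrib (hfin' g₁) (hfin' g₂)]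
        refine finsum_congr fun l => ?_
        rw [← add_smul]
        congr 1
        simp only [a, Submodule.coe_add, add_apply, mul_add]
        exact integral_add (hint l g₁) (hint l g₂)
      map_smul' := fun r g => by
        rw [RingHom.id_apply, smul_finsum]
        refine finsum_congr fun l => ?_
        rw [smul_smul]
        congr 1
        simp only [a, Submodule.coe_smul, smul_apply, smul_eq_mul]
        rw [← integral_const_mul]
        refine integral_congr_ae (Filter.Eventually.of_forall fun t => ?_)
        ring }
  have he : DenseRange e := by
    have h1 : DenseRange ((↑) : compactSchwartz (Rn n) → 𝓢(Rn n, ℂ)) :=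
      dense_compactSchwartz.denseRange_val
    exact hd.comp h1 j.continuous
  have hf : ∀ g, ‖f g‖ ≤ C * ‖e g‖ := by
    intro g
    let h : 𝓢(Rn n, ℂ) := ∑ l ∈ (hfin g).toFinset, a l g • twistedSchwartz B hχ hχc l
    have h1 : f g = j h := by
      change ∑ᶠ l : Λ, a l g • j (twistedSchwartz B hχ hχc l) = _
      rw [finsum_eq_finsetSum_of_support_subset (s := (hfin g).toFinset)]
      · simp only [h, map_sum, map_smul]
      · intro l hl
        rw [Set.Finite.coe_toFinset]
        exact fun h0 => hl (by simp only at h0; simp only [h0, zero_smul])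
    rw [h1]
    refine hbound g h g.2 fun t => ?_
    have h2 : h t = ∑ l ∈ (hfin g).toFinset, a l g * twistedTranslation B l χ t := by
      simp only [h, sum_apply, smul_apply, smul_eq_mul, twistedSchwartz_apply]
    rw [h2, finsum_eq_finsetSum_of_support_subset (s := (hfin g).toFinset)]
    · refine Finset.sum_congr rfl fun l _ => ?_
      simp only [a, mul_comm]
    · intro l hl
      rw [Set.Finite.coe_toFinset]
      have := left_ne_zero_of_mul hl
      simpa only [a, mul_comm, Function.mem_support] using this
  refine ⟨f.extendOfNorm e, fun g hg => ?_⟩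
  exact LinearMap.extendOfNorm_eq he ⟨C, hf⟩ (⟨g, hg⟩ : compactSchwartz (Rn n))

/-- The frame operator acts boundedly on `E`, in terms of its action on distributions. For a DTMIB it
is the transpose of a frame operator on the predual, that with `ψ` and `χ` interchanged and `B`
replaced by `-B`. -/
theorem exists_transfer (hE : IsTMIB ι ∨ IsDTMIB.{u, v} ι)
    (hψ : ContDiff ℝ ∞ ψ) (hψc : HasCompactSupport ψ)
    (hχ : ContDiff ℝ ∞ χ) (hχc : HasCompactSupport χ) :
    ∃ C : ℝ, 0 ≤ C ∧ ∀ e : E, ∃ e' : E, ‖e'‖ ≤ C * ‖e‖ ∧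
      ∀ φ : 𝓢(Rn n, ℂ), HasCompactSupport φ → ι e' φ =
        ∑ᶠ l : Λ, ι e (twistedSchwartz (-B) hψ hψc l) *
          ∫ t, twistedTranslation B l χ t * φ t := by
  rcases hE with hι | ⟨E₀, _, _, ι₀, hι₀, Φ, hΦ⟩
  · obtain ⟨j, hd, hj⟩ := hι.dense_schwartz
    obtain ⟨A, hA⟩ := hι.exists_frameOperator B Λ hd hj hψ hψc hχ hχc
    refine ⟨‖A‖, norm_nonneg _, fun e => ⟨A e, A.le_opNorm e, fun φ hφ => ?_⟩⟩
    have hfin := finite_setOf_integral_twistedTranslation_ne_zero (B := B) Λ hχc hφ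
    have hsum : ∀ e : E, ∑ᶠ l : Λ, ι e (twistedSchwartz (-B) hψ hψc l) *
        ∫ t, twistedTranslation B l χ t * φ t = ∑ l ∈ hfin.toFinset,
          evalAt ι (twistedSchwartz (-B) hψ hψc l) e * ∫ t, twistedTranslation B l χ t * φ t := by
      intro e
      refine finsum_eq_finsetSum_of_support_subset _ fun l hl => ?_
      rw [Set.Finite.coe_toFinset]
      exact right_ne_zero_of_mul hl
    have hdense : DenseRange fun g : compactSchwartz (Rn n) => j g :=
      hd.comp dense_compactSchwartz.denseRange_val j.continuous
    refine hdense.induction_on (p := fun e => ι (A e) φ =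
        ∑ᶠ l : Λ, ι e (twistedSchwartz (-B) hψ hψc l) *
          ∫ t, twistedTranslation B l χ t * φ t) e ?_ fun g => ?_
    · simp only [hsum]
      exact isClosed_eq ((evalAt ι φ).continuous.comp A.continuous)
        (by fun_prop)
    · rw [hA g g.2, ← evalAt_apply, map_finsum]
      · refine finsum_congr fun l => ?_
        rw [map_smul, evalAt_apply, apply_of_eq_toTemperedDistribution hj,
          apply_of_eq_toTemperedDistribution hj, smul_eq_mul]
        congr 1
        refine integral_congr_ae (Filter.Eventually.of_forall fun t => ?_)
        exact mul_comm _ _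
      · refine (finite_setOf_integral_twistedTranslation_ne_zero (B := -B) Λ hψc g.2).subset
          fun l hl h0 => hl ?_
        simp only [h0, zero_smul]
  · obtain ⟨j, hd, hj⟩ := hι₀.dense_schwartz
    obtain ⟨A, hA⟩ := hι₀.exists_frameOperator (-B) Λ hd hj hχ hχc hψ hψc
    refine ⟨‖A‖, norm_nonneg _, fun e => ⟨Φ.symm ((Φ e).comp A), ?_, fun φ hφ => ?_⟩⟩
    · rw [LinearIsometryEquiv.norm_map, mul_comm, ← Φ.norm_map e]
      exact ContinuousLinearMap.opNorm_comp_le _ _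
    · rw [hΦ _ φ (j φ) (hj φ), LinearIsometryEquiv.apply_symm_apply,
        ContinuousLinearMap.comp_apply, hA φ hφ, map_finsum]
      · refine finsum_congr fun l => ?_
        rw [map_smul, hΦ e _ _ (hj _), smul_eq_mul, mul_comm, neg_neg]
      · refine (finite_setOf_integral_twistedTranslation_ne_zero (B := - -B) Λ hχc hφ).subset
          fun l hl h0 => hl ?_
        simp only [h0, zero_smul]

end Transfer

/-! ### The discrete spaces -/

section Discrete

variable {n : ℕ} {E : Type u} [NormedAddCommGroup E] [NormedSpace ℂ E]
  {ι : E →L[ℂ] 𝓢'(Rn n, ℂ)}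

theorem completeSpace_of_isTMIB_or_isDTMIB (hE : IsTMIB ι ∨ IsDTMIB.{u, v} ι) :
    CompleteSpace E := by
  rcases hE with hι | ⟨E₀, _, _, ι₀, hι₀, Φ, hΦ⟩
  · exact hι.complete
  · exact (completeSpace_congr (e := Φ.toEquiv) Φ.isometry.isUniformEmbedding).2 inferInstance

theorem injective_of_isTMIB_or_isDTMIB (hE : IsTMIB ι ∨ IsDTMIB.{u, v} ι) :
    Function.Injective ι := by
  rcases hE with hι | ⟨E₀, _, _, ι₀, hι₀, Φ, hΦ⟩
  · exact hι.injective
  · obtain ⟨j, hd, hj⟩ := hι₀.dense_schwartz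
    refine (injective_iff_map_eq_zero ι).2 fun e he => ?_
    have h : Φ e = 0 := by
      refine ContinuousLinearMap.coeFn_injective
        (hd.equalizer (Φ e).continuous continuous_const ?_)
      ext φ
      change Φ e (j φ) = 0
      rw [← hΦ e φ (j φ) (hj φ), he]
      rfl
    simpa using h

/-- A tempered distribution is determined by its values on compactly supported functions. -/
theorem eq_of_eqOn_compactSchwartz {u w : 𝓢'(Rn n, ℂ)}
    (h : ∀ φ : 𝓢(Rn n, ℂ), HasCompactSupport φ → u φ = w φ) : u = w := by
  refine DFunLike.coe_injective (Continuous.ext_on dense_compactSchwartz (map_continuous u)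
    (map_continuous w) fun φ hφ => h φ hφ)

variable {B : Matrix (Fin n) (Fin n) ℝ} {Λ : Submodule ℤ (Rn n)} {χ : Rn n → ℂ}

theorem eq_of_eqInDistributions (hinj : Function.Injective ι) {f : Rn n → ℂ} {e e' : E}
    (h : EqInDistributions (ι e) f) (h' : EqInDistributions (ι e') f) : e = e' :=
  hinj (eq_of_eqOn_compactSchwartz fun φ hφ => (h φ hφ).trans (h' φ hφ).symm)

theorem discreteNorm_eq (hinj : Function.Injective ι) {c : Λ → ℂ} {e : E}
    (h : EqInDistributions (ι e) (synthesis B Λ χ c)) : discreteNorm ι B Λ χ c = ‖e‖ := by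
  have : {r : ℝ | ∃ e : E, EqInDistributions (ι e) (synthesis B Λ χ c) ∧ r = ‖e‖} = {‖e‖} := by
    ext r
    constructor
    · rintro ⟨e', he', rfl⟩
      rw [eq_of_eqInDistributions hinj h he']
      rfl
    · rintro rfl
      exact ⟨e, h, rfl⟩
  rw [discreteNorm, this, csInf_singleton]

theorem eqInDistributions_zero :
    EqInDistributions (ι 0) (synthesis B Λ χ 0) := by
  intro φ hφ
  rw [map_zero]
  simp [synthesis]

variable [DiscreteTopology Λ]

theorem eqInDistributions_synthesis_iff (hχ : ContDiff ℝ ∞ χ) (hχc : HasCompactSupport χ)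
    {u : 𝓢'(Rn n, ℂ)} {c : Λ → ℂ} :
    EqInDistributions u (synthesis B Λ χ c) ↔
      ∀ φ : 𝓢(Rn n, ℂ), HasCompactSupport φ →
        u φ = ∑ᶠ l : Λ, c l * ∫ t, twistedTranslation B l χ t * φ t := by
  refine forall₂_congr fun φ hφ => ?_
  rw [integral_synthesis_mul Λ hχ hχc c φ hφ]

/-- The linear combination of distributions given by synthesis is given by the synthesis of the
linear combination. -/
theorem EqInDistributions.add_smul (hχ : ContDiff ℝ ∞ χ) (hχc : HasCompactSupport χ)
    {e d : E} {b c : Λ → ℂ} (a : ℂ) (he : EqInDistributions (ι e) (synthesis B Λ χ b))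
    (hd : EqInDistributions (ι d) (synthesis B Λ χ c)) :
    EqInDistributions (ι (e + a • d)) (synthesis B Λ χ (b + a • c)) := by
  rw [eqInDistributions_synthesis_iff hχ hχc] at he hd ⊢
  intro φ hφ
  have hfin := finite_setOf_integral_twistedTranslation_ne_zero (B := B) Λ hχc hφ
  rw [← evalAt_apply, map_add, map_smul, evalAt_apply, evalAt_apply, he φ hφ, hd φ hφ,
    smul_finsum, ← finsum_add_distrib]
  · refine finsum_congr fun l => ?_
    simp only [Pi.add_apply, Pi.smul_apply, smul_eq_mul]
    ring
  · exact hfin.subset fun l hl => right_ne_zero_of_mul hl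
  · exact hfin.subset fun l hl => right_ne_zero_of_mul (right_ne_zero_of_mul hl)

/-- The coefficients of a synthesized distribution are recovered by testing against the dual
system. -/
theorem EqInDistributions.apply_twistedSchwartz {U : Set (Rn n)}
    (hU : Pairwise fun l m : Λ => Disjoint ((fun t => (l : Rn n) + t) '' U)
        ((fun t => (m : Rn n) + t) '' U))
    (hχ : ContDiff ℝ ∞ χ) (hχc : HasCompactSupport χ) (hχU : Function.support χ ⊆ U)
    {ψ : Rn n → ℂ} (hψ : ContDiff ℝ ∞ ψ) (hψc : HasCompactSupport ψ)
    (hψU : Function.support ψ ⊆ U) (hχψ : ∫ t, χ t * ψ t = 1) {u : 𝓢'(Rn n, ℂ)} {c : Λ → ℂ}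
    (hu : EqInDistributions u (synthesis B Λ χ c)) (l : Λ) :
    u (twistedSchwartz (-B) hψ hψc l) = c l := by
  classical
  rw [(eqInDistributions_synthesis_iff hχ hχc).1 hu _
    (hasCompactSupport_twistedSchwartz hψ hψc _)]
  simp only [twistedSchwartz_apply, integral_twistedTranslation_mul Λ hU hχU hψU, hχψ]
  rw [finsum_eq_single _ l]
  · simp
  · intro m hm
    simp [hm]

/-- Completeness holds because the coefficients depend continuously on the distribution, so that a
limit in `E` of synthesized distributions is synthesized from the limit of the coefficients. -/
theorem isBanachSpaceOn_discreteSpace [CompleteSpace E] (hinj : Function.Injective ι)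
    {U : Set (Rn n)}
    (hU : Pairwise fun l m : Λ => Disjoint ((fun t => (l : Rn n) + t) '' U)
        ((fun t => (m : Rn n) + t) '' U))
    (hχ : ContDiff ℝ ∞ χ) (hχc : HasCompactSupport χ) (hχU : Function.support χ ⊆ U)
    (hχ0 : χ ≠ 0) :
    IsBanachSpaceOn (discreteSpace ι B Λ χ) (discreteNorm ι B Λ χ) := by
  obtain ⟨ψ, hψ, hψc, hψχ, hχψ⟩ := exists_dual_function hχ hχc hχ0
  have hadd : ∀ {e d : E} {b c : Λ → ℂ}, EqInDistributions (ι e) (synthesis B Λ χ b) →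
      EqInDistributions (ι d) (synthesis B Λ χ c) →
      EqInDistributions (ι (e + d)) (synthesis B Λ χ (b + c)) := fun he hd => by
    simpa only [one_smul] using he.add_smul hχ hχc 1 hd
  have hsub : ∀ {e d : E} {b c : Λ → ℂ}, EqInDistributions (ι e) (synthesis B Λ χ b) →
      EqInDistributions (ι d) (synthesis B Λ χ c) →
      EqInDistributions (ι (e - d)) (synthesis B Λ χ (b - c)) := fun he hd => by
    simpa only [neg_one_smul, ← sub_eq_add_neg] using he.add_smul hχ hχc (-1) hd
  have hsmul : ∀ {e : E} {c : Λ → ℂ} (a : ℂ), EqInDistributions (ι e) (synthesis B Λ χ c) →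
      EqInDistributions (ι (a • e)) (synthesis B Λ χ (a • c)) := fun a he => by
    simpa only [zero_add] using eqInDistributions_zero.add_smul hχ hχc a he
  have hcoeff : ∀ {e : E} {c : Λ → ℂ}, EqInDistributions (ι e) (synthesis B Λ χ c) →
      ∀ l : Λ, ι e (twistedSchwartz (-B) hψ hψc l) = c l := fun he l =>
    he.apply_twistedSchwartz hU hχ hχc hχU hψ hψc (hψχ.trans hχU) hχψ l
  constructor
  · exact ⟨0, eqInDistributions_zero⟩
  · rintro c ⟨e, he⟩ d ⟨e', he'⟩
    exact ⟨e + e', hadd he he'⟩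
  · rintro a c ⟨e, he⟩
    exact ⟨a • e, hsmul a he⟩
  · rintro c ⟨e, he⟩
    rw [discreteNorm_eq hinj he]
    exact norm_nonneg e
  · rintro c ⟨e, he⟩
    rw [discreteNorm_eq hinj he, norm_eq_zero]
    constructor
    · rintro rfl
      ext l
      rw [← hcoeff he l, map_zero]
      rfl
    · rintro rfl
      exact eq_of_eqInDistributions hinj he eqInDistributions_zero
  · rintro a c ⟨e, he⟩
    rw [discreteNorm_eq hinj he, discreteNorm_eq hinj (hsmul a he), norm_smul]
  · rintro c ⟨e, he⟩ d ⟨e', he'⟩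
    rw [discreteNorm_eq hinj he, discreteNorm_eq hinj he', discreteNorm_eq hinj (hadd he he')]
    exact norm_add_le e e'
  · intro s hs hcauchy
    choose e he using hs
    have hnorm : ∀ k l, discreteNorm ι B Λ χ (s k - s l) = ‖e k - e l‖ := fun k l =>
      discreteNorm_eq hinj (hsub (he k) (he l))
    have hce : CauchySeq e := by
      refine Metric.cauchySeq_iff.2 fun ε hε => ?_
      obtain ⟨K, hK⟩ := hcauchy ε hε
      refine ⟨K, fun k hk l hl => ?_⟩
      rw [dist_eq_norm, ← hnorm]
      exact hK k hk l hl
    obtain ⟨d, hd⟩ := cauchySeq_tendsto_of_complete hce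
    have hlim : ∀ φ, Filter.Tendsto (fun k => ι (e k) φ) Filter.atTop (nhds (ι d φ)) := fun φ =>
      ((evalAt ι φ).continuous.tendsto d).comp hd
    let c : Λ → ℂ := fun l => ι d (twistedSchwartz (-B) hψ hψc l)
    have hc : ∀ l, Filter.Tendsto (fun k => s k l) Filter.atTop (nhds (c l)) := fun l => by
      simpa only [fun k => hcoeff (he k) l] using hlim (twistedSchwartz (-B) hψ hψc l)
    have hdc : EqInDistributions (ι d) (synthesis B Λ χ c) := by
      rw [eqInDistributions_synthesis_iff hχ hχc]
      intro φ hφ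
      have hfin := finite_setOf_integral_twistedTranslation_ne_zero (B := B) Λ hχc hφ
      have hsum : ∀ c : Λ → ℂ, ∑ᶠ l : Λ, c l * ∫ t, twistedTranslation B l χ t * φ t =
          ∑ l ∈ hfin.toFinset, c l * ∫ t, twistedTranslation B l χ t * φ t := fun c =>
        finsum_eq_finsetSum_of_support_subset _ fun l hl => by
          rw [Set.Finite.coe_toFinset]
          exact right_ne_zero_of_mul hl
      rw [hsum]
      refine tendsto_nhds_unique (hlim φ) ?_
      have : ∀ k, ι (e k) φ = ∑ l ∈ hfin.toFinset, s k l *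
          ∫ t, twistedTranslation B l χ t * φ t := fun k => by
        rw [(eqInDistributions_synthesis_iff hχ hχc).1 (he k) φ hφ, hsum]
      simp only [this]
      exact tendsto_finsetSum _ fun l _ => (hc l).mul_const _
    refine ⟨c, ⟨d, hdc⟩, ?_⟩
    have : ∀ k, discreteNorm ι B Λ χ (s k - c) = ‖e k - d‖ := fun k =>
      discreteNorm_eq hinj (hsub (he k) hdc)
    simp only [this]
    exact tendsto_iff_norm_sub_tendsto_zero.1 hd

/-- Changing the window: if `S_χ₁(c)` belongs to `E`, then so does `S_χ₂(c)`, with a norm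
estimate. -/
theorem exists_change_window [IsZLattice ℝ Λ] (hE : IsTMIB ι ∨ IsDTMIB.{u, v} ι)
    (B : Matrix (Fin n) (Fin n) ℝ) {U : Set (Rn n)}
    (hU : Pairwise fun l m : Λ => Disjoint ((fun t => (l : Rn n) + t) '' U)
        ((fun t => (m : Rn n) + t) '' U))
    {χ₁ χ₂ : Rn n → ℂ} (hχ₁ : ContDiff ℝ ∞ χ₁) (hχ₁c : HasCompactSupport χ₁)
    (hχ₁U : Function.support χ₁ ⊆ U) (hχ₁0 : χ₁ ≠ 0)
    (hχ₂ : ContDiff ℝ ∞ χ₂) (hχ₂c : HasCompactSupport χ₂) :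
    ∃ C : ℝ, 0 ≤ C ∧ ∀ c ∈ discreteSpace ι B Λ χ₁, c ∈ discreteSpace ι B Λ χ₂ ∧
      discreteNorm ι B Λ χ₂ c ≤ C * discreteNorm ι B Λ χ₁ c := by
  obtain ⟨ψ, hψ, hψc, hψχ, hχψ⟩ := exists_dual_function hχ₁ hχ₁c hχ₁0
  obtain ⟨C, hC, h⟩ := exists_transfer B Λ hE hψ hψc hχ₂ hχ₂c
  have hinj := injective_of_isTMIB_or_isDTMIB hE
  refine ⟨C, hC, ?_⟩
  rintro c ⟨e, he⟩
  obtain ⟨e', he', hφ⟩ := h e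
  have hc : EqInDistributions (ι e') (synthesis B Λ χ₂ c) := by
    rw [eqInDistributions_synthesis_iff hχ₂ hχ₂c]
    intro φ hφc
    rw [hφ φ hφc]
    simp only [he.apply_twistedSchwartz hU hχ₁ hχ₁c hχ₁U hψ hψc (hψχ.trans hχ₁U) hχψ]
  refine ⟨⟨e', hc⟩, ?_⟩
  rw [discreteNorm_eq hinj hc, discreteNorm_eq hinj he]
  exact he'

end Discrete

end DiscreteTMIB

open DiscreteTMIB
theorem theorem5p2 {n : ℕ} {E : Type u} [NormedAddCommGroup E] [NormedSpace ℂ E]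
    (ι : E →L[ℂ] 𝓢'(Rn n, ℂ)) (hE : IsTMIB ι ∨ IsDTMIB.{u, v} ι)
    (B : Matrix (Fin n) (Fin n) ℝ)
    (Λ : Submodule ℤ (Rn n)) [DiscreteTopology Λ] [IsZLattice ℝ Λ]
    (U : TopologicalSpace.Opens (Rn n)) (hU_bounded : Bornology.IsBounded (U : Set (Rn n)))
    (hU_zero : (0 : Rn n) ∈ U)
    (hU_disjoint : Pairwise fun l m : Λ =>
      Disjoint ((fun t => (l : Rn n) + t) '' (U : Set (Rn n)))
        ((fun t => (m : Rn n) + t) '' (U : Set (Rn n)))) :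
    (∀ χ : 𝓓(U, ℂ), χ ≠ 0 →
      IsBanachSpaceOn (discreteSpace ι B Λ χ) (discreteNorm ι B Λ χ)) ∧
    (∀ χ₁ χ₂ : 𝓓(U, ℂ), χ₁ ≠ 0 → χ₂ ≠ 0 →
      discreteSpace ι B Λ χ₁ = discreteSpace ι B Λ χ₂ ∧
      ∃ C > (0 : ℝ), ∀ c ∈ discreteSpace ι B Λ χ₁,
        discreteNorm ι B Λ χ₁ c ≤ C * discreteNorm ι B Λ χ₂ c ∧
        discreteNorm ι B Λ χ₂ c ≤ C * discreteNorm ι B Λ χ₁ c) := by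
  have := completeSpace_of_isTMIB_or_isDTMIB hE
  have hinj := injective_of_isTMIB_or_isDTMIB hE
  have hsupp : ∀ χ : 𝓓(U, ℂ), Function.support χ ⊆ (U : Set (Rn n)) := fun χ =>
    (subset_tsupport _).trans χ.tsupport_subset
  have hne : ∀ χ : 𝓓(U, ℂ), χ ≠ 0 → (χ : Rn n → ℂ) ≠ 0 := fun χ h h0 =>
    h (DFunLike.coe_injective h0)
  refine ⟨fun χ hχ => isBanachSpaceOn_discreteSpace hinj hU_disjoint χ.contDiff
    χ.hasCompactSupport (hsupp χ) (hne χ hχ), fun χ₁ χ₂ h₁ h₂ => ?_⟩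
  obtain ⟨C, hC, h12⟩ := exists_change_window hE B hU_disjoint χ₁.contDiff χ₁.hasCompactSupport
    (hsupp χ₁) (hne χ₁ h₁) χ₂.contDiff χ₂.hasCompactSupport
  obtain ⟨C', hC', h21⟩ := exists_change_window hE B hU_disjoint χ₂.contDiff
    χ₂.hasCompactSupport (hsupp χ₂) (hne χ₂ h₂) χ₁.contDiff χ₁.hasCompactSupport
  refine ⟨Set.Subset.antisymm (fun c hc => (h12 c hc).1) (fun c hc => (h21 c hc).1),
    C + C' + 1, by positivity, fun c hc => ?_⟩
  have hb := isBanachSpaceOn_discreteSpace (B := B) hinj hU_disjoint χ₁.contDiff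
    χ₁.hasCompactSupport (hsupp χ₁) (hne χ₁ h₁)
  have hb' := isBanachSpaceOn_discreteSpace (B := B) hinj hU_disjoint χ₂.contDiff
    χ₂.hasCompactSupport (hsupp χ₂) (hne χ₂ h₂)
  have hc' := (h12 c hc).1
  exact ⟨(h21 c hc').2.trans (mul_le_mul_of_nonneg_right (by linarith) (hb'.norm_nonneg c hc')),
    (h12 c hc).2.trans (mul_le_mul_of_nonneg_right (by linarith) (hb.norm_nonneg c hc))⟩
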